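/- Let $(M,F)$ be a Finsler manifold of dimension $n\ge 1$: $M$ is a smooth $n$-manifold and $F:TM_0=TM\setminus 0\to\mathbb R^+$ is smooth, $F(x,\lambda y)=\lambda F(x,y)$ for $\lambda>0$, and the matrix $g_{ij}=\frac12[F^2]_{y^iy^j}$ is positive definite on $TM_0$ in local coordinates $(x,y)$. Let $\pi:SM=TM_0/\mathbb R^+\to M$ be the projective sphere bundle; $g=g_{ij}dx^i\otimes dx^j$ is a Euclidean metric on $\pi^*TM$, with the distinguished section $l(x,[y])=y/F(x,y)$. Put $G^i=\frac14 g^{ij}\big([F^2]_{y^jx^k}y^k-[F^2]_{x^j}\big)$, $\frac{\delta}{\delta x^i}=\frac{\partial}{\partial x^i}-\frac{\partial G^j}{\partial y^i}\frac{\partial}{\partial y^j}$, $\frac{\delta}{\delta y^i}=F\frac{\partial}{\partial y^i}$, and let $J$ be the almost complex structure on $TM_0$ with $J\frac{\delta}{\delta x^i}=\frac{\delta}{\delta y^i}$, $J\frac{\delta}{\delta y^i}=-\frac{\delta}{\delta x^i}$. Over an open set $W\subset SM$ lying over a coordinate domain of $M$, let $e_1,\dots,e_n$ with $e_n=l$ be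 a smooth orthonormal frame of $(\pi^*TM,g)$, with dual frame $\omega^1,\dots,\omega^n$, regarded also as one forms on $SM$ and on $TM_0$. For $1\le\alpha\le n-1$ put $\omega^{n+\alpha}=J^*\omega^\alpha$, which descends to a one form on $SM$. Let $\mathbf e_1,\dots,\mathbf e_{2n-1}$ be the local frame of $T(SM)$ dual to the coframe $\omega^1,\dots,\omega^{2n-1}$, let $g^{T(SM)}=\sum_{a=1}^{2n-1}\omega^a\otimes\omega^a$ be the Sasaki-type metric, and let $\nabla$ be its Levi-Civita connection. Let $V(SM)=\ker d\pi$, let $H(SM)$ be its orthogonal complement (so $\mathbf e_1,\dots,\mathbf e_n$ is a frame of $H(SM)$), and let $p^\perp:T(SM)\to H(SM)$ be the orthogonal projection. The Bott connection $\widetilde\nabla$ on $H(SM)$ is defined by $\widetilde\nabla_XU=p^\perp[X,U]$ for $X$ a section of $V(SM)$ and $\widetilde\nabla_XU=p^\perp\nabla_XU$ for $X$ a section of $H(SM)$. Then $\widetilde\nabla$ has connection forms $\omega_i^j$ in this frame, i.e. one forms with $\widetilde\nabla\mathbf e_i=\sum_{j=1}^n\omega_i^j\,\mathbf e_j$ for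 $1\le i\le n$, and they satisfy $$\omega_\alpha^n=-\omega_n^\alpha=\omega^{n+\alpha}\quad(1\le\alpha\le n-1),\qquad \omega_n^n=0 .$$ -/

import Mathlib

open Set Filter Topology Manifold
open scoped ContDiff Manifold

noncomputable section

/-- `ℝⁿ` with its Euclidean structure, the model space of `n`-dimensional manifolds. -/
abbrev Vec (n : ℕ) := EuclideanSpace ℝ (Fin n)

section SphereBundle

variable {m : ℕ} {M : Type*} [TopologicalSpace M] [ChartedSpace (Vec (m + 1)) M]

/-- The differential of a chart `c` at `x`, read as a map into `ℝⁿ`: it sends `y ∈ T_xM` to its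
components `(y¹, …, yⁿ)` in the coordinates `c`. -/
def chartD (c : OpenPartialHomeomorph M (Vec (m + 1))) (x : M) :
    TangentSpace (𝓡 (m + 1)) x →L[ℝ] Vec (m + 1) :=
  mfderiv (𝓡 (m + 1)) (𝓡 (m + 1)) c x

/-- The differential of the inverse of a chart `c`: it sends `(y¹, …, yⁿ)` to `yⁱ ∂/∂xⁱ`. -/
def chartDSymm (c : OpenPartialHomeomorph M (Vec (m + 1))) (a : Vec (m + 1)) :
    Vec (m + 1) →L[ℝ] TangentSpace (𝓡 (m + 1)) (c.symm a) :=
  mfderiv (𝓡 (m + 1)) (𝓡 (m + 1)) c.symm a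

variable (m M) in
/-- The projective sphere bundle `SM = TM₀ / ℝ⁺`: a point is a point of `M` with a ray (a class of
nonzero tangent vectors modulo positive multiples) in the tangent space there. -/
structure SphereBundle where
  /-- the foot point, i.e. the projection `π : SM → M` -/
  pt : M
  /-- the direction `[y]` -/
  dir : Module.Ray ℝ (TangentSpace (𝓡 (m + 1)) pt)

theorem single_zero_ne_zero : (EuclideanSpace.single (0 : Fin (m + 1)) (1 : ℝ) : Vec (m + 1)) ≠ 0 := by
  intro h
  simpa using congrArg (fun v : Vec (m + 1) => v 0) h

/-- The quotient map `TM₀ → SM`, `(x, w) ↦ (x, [w])` (with a junk value at `w = 0`). -/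
def SphereBundle.ofVec (x : M) (w : Vec (m + 1)) : SphereBundle m M :=
  open Classical in
  ⟨x, if h : w ≠ 0 then rayOfNeZero ℝ (M := TangentSpace (𝓡 (m + 1)) x) w h else
    rayOfNeZero ℝ (M := TangentSpace (𝓡 (m + 1)) x)
      (EuclideanSpace.single (0 : Fin (m + 1)) (1 : ℝ) : Vec (m + 1))
      single_zero_ne_zero⟩

/-- An arbitrary representative of the direction of a point of `SM`. -/
def SphereBundle.rep (p : SphereBundle m M) : TangentSpace (𝓡 (m + 1)) p.pt := p.dir.someVector

theorem SphereBundle.rep_ne_zero (p : SphereBundle m M) : p.rep ≠ 0 :=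
  p.dir.someVector_ne_zero

theorem SphereBundle.ofVec_congr {x x' : M} {w w' : Vec (m + 1)} {r : ℝ} (hx : x = x')
    (hr : 0 < r) (hw : w = r • w') : (SphereBundle.ofVec x w) = SphereBundle.ofVec x' w' := by
  subst hx hw
  by_cases h : w' = 0
  · simp [h]
  · unfold SphereBundle.ofVec
    congr 1
    rw [dif_pos (smul_ne_zero hr.ne' h), dif_pos h]
    exact (ray_eq_iff _ _).2 (SameRay.sameRay_pos_smul_left (R := ℝ) (M := Vec (m + 1)) w' hr)

theorem SphereBundle.ofVec_rep (p : SphereBundle m M) : SphereBundle.ofVec p.pt p.rep = p := by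
  rcases p with ⟨x, d⟩
  unfold SphereBundle.ofVec
  congr 1
  exact (dif_pos (SphereBundle.rep_ne_zero ⟨x, d⟩)).trans d.someVector_ray

theorem SphereBundle.rep_ofVec (x : M) {w : Vec (m + 1)} (hw : w ≠ 0) :
    ∃ r : ℝ, 0 < r ∧ ((SphereBundle.ofVec x w).rep : Vec (m + 1)) = r • w := by
  have h := SphereBundle.ofVec_rep (SphereBundle.ofVec x w)
  have h1 := SphereBundle.rep_ne_zero (SphereBundle.ofVec x w)
  have h2 : (SphereBundle.ofVec x w).dir =
      rayOfNeZero ℝ (M := TangentSpace (𝓡 (m + 1)) x) w hw := by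
    unfold SphereBundle.ofVec
    simp only
    rw [dif_pos hw]
  have h3 : SameRay ℝ ((SphereBundle.ofVec x w).rep : Vec (m + 1)) w := by
    have h4 : rayOfNeZero ℝ (M := TangentSpace (𝓡 (m + 1)) x) (SphereBundle.ofVec x w).rep h1 =
        rayOfNeZero ℝ (M := TangentSpace (𝓡 (m + 1)) x) w hw :=
      (SphereBundle.ofVec x w).dir.someVector_ray.trans h2
    exact (ray_eq_iff _ _).1 h4
  obtain ⟨r, hr, h⟩ := h3.symm.exists_pos_left hw h1
  exact ⟨r, hr, h.symm⟩

theorem chart_mdifferentiable [IsManifold (𝓡 (m + 1)) ∞ M]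
    {c : OpenPartialHomeomorph M (Vec (m + 1))}
    (hc : c ∈ IsManifold.maximalAtlas (𝓡 (m + 1)) ∞ M) :
    c.MDifferentiable (𝓡 (m + 1)) (𝓡 (m + 1)) :=
  ⟨(contMDiffOn_of_mem_maximalAtlas hc).mdifferentiableOn (by simp),
    (contMDiffOn_symm_of_mem_maximalAtlas hc).mdifferentiableOn (by simp)⟩

theorem chartD_chartDSymm [IsManifold (𝓡 (m + 1)) ∞ M]
    {c : OpenPartialHomeomorph M (Vec (m + 1))}
    (hc : c ∈ IsManifold.maximalAtlas (𝓡 (m + 1)) ∞ M) {a : Vec (m + 1)} (ha : a ∈ c.target)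
    (w : Vec (m + 1)) : chartD c (c.symm a) (chartDSymm c a w) = w :=
  DFunLike.congr_fun ((chart_mdifferentiable hc).comp_symm_deriv ha) w

theorem chartDSymm_chartD [IsManifold (𝓡 (m + 1)) ∞ M]
    {c : OpenPartialHomeomorph M (Vec (m + 1))}
    (hc : c ∈ IsManifold.maximalAtlas (𝓡 (m + 1)) ∞ M) {x : M} (hx : x ∈ c.source)
    (w : TangentSpace (𝓡 (m + 1)) x) :
    (chartDSymm c (c x) (chartD c x w) : Vec (m + 1)) = (w : Vec (m + 1)) :=
  DFunLike.congr_fun ((chart_mdifferentiable hc).symm_comp_deriv hx) w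

theorem chartD_rep_ofVec [IsManifold (𝓡 (m + 1)) ∞ M]
    (c c' : OpenPartialHomeomorph M (Vec (m + 1)))
    (hc : c ∈ IsManifold.maximalAtlas (𝓡 (m + 1)) ∞ M) {a : Vec (m + 1)} (ha : a ∈ c.target)
    {w : Vec (m + 1)} (hw : w ≠ 0) :
    ∃ r : ℝ, 0 < r ∧ chartD c' (c.symm a) (SphereBundle.ofVec (c.symm a) (chartDSymm c a w)).rep =
      r • chartD c' (c.symm a) (chartDSymm c a w) := by
  have h0 : (chartDSymm c a w : Vec (m + 1)) ≠ 0 := by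
    intro h
    have h1 := chartD_chartDSymm hc ha w
    have h2 : chartDSymm c a w = 0 := h
    rw [h2, map_zero] at h1
    exact hw h1.symm
  obtain ⟨r, hr, h⟩ := SphereBundle.rep_ofVec (c.symm a) h0
  refine ⟨r, hr, ?_⟩
  have h' : (SphereBundle.ofVec (c.symm a) (chartDSymm c a w)).rep = r • chartDSymm c a w := h
  exact (congrArg (chartD c' (c.symm a)) h').trans (map_smul _ _ _)

theorem sphereChart_aux' [IsManifold (𝓡 (m + 1)) ∞ M]
    (c c' : OpenPartialHomeomorph M (Vec (m + 1)))
    (hc : c ∈ IsManifold.maximalAtlas (𝓡 (m + 1)) ∞ M) (A : Vec (m + 1) ≃L[ℝ] ℝ × Vec m)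
    {a : Vec (m + 1)} (ha : a ∈ c.target) (z : Vec m) :
    ∃ r : ℝ, 0 < r ∧ chartD c' (c.symm a) (SphereBundle.ofVec (c.symm a)
      (chartDSymm c a (A.symm (1, z)))).rep =
        r • chartD c' (c.symm a) (chartDSymm c a (A.symm (1, z))) := by
  refine chartD_rep_ofVec c c' hc ha ?_
  intro h
  have := congrArg (fun v => (A v).1) h
  simp at this

theorem sphereChart_aux [IsManifold (𝓡 (m + 1)) ∞ M] {c : OpenPartialHomeomorph M (Vec (m + 1))}
    (hc : c ∈ IsManifold.maximalAtlas (𝓡 (m + 1)) ∞ M) (A : Vec (m + 1) ≃L[ℝ] ℝ × Vec m)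
    {a : Vec (m + 1)} (ha : a ∈ c.target) (z : Vec m) :
    ∃ r : ℝ, 0 < r ∧ chartD c (c.symm a) (SphereBundle.ofVec (c.symm a)
      (chartDSymm c a (A.symm (1, z)))).rep = r • A.symm (1, z) := by
  obtain ⟨r, hr, h⟩ := sphereChart_aux' c c hc A ha z
  exact ⟨r, hr, h.trans (by rw [chartD_chartDSymm hc ha])⟩

/-- The chart of `SM` given by a chart `c` of `M` and a linear isomorphism `A : ℝⁿ ≅ ℝ × ℝⁿ⁻¹`: on
the set of `(x, [y])` with `x` in the domain of `c` and `A(y) = (t, z)` with `t > 0`, it is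
`(x, [y]) ↦ (c(x), z / t)`. -/
def sphereChart [IsManifold (𝓡 (m + 1)) ∞ M] (c : OpenPartialHomeomorph M (Vec (m + 1)))
    (hc : c ∈ IsManifold.maximalAtlas (𝓡 (m + 1)) ∞ M) (A : Vec (m + 1) ≃L[ℝ] ℝ × Vec m) :
    PartialEquiv (SphereBundle m M) (Vec (m + 1) × Vec m) where
  toFun p := (c p.pt, (A (chartD c p.pt p.rep)).1⁻¹ • (A (chartD c p.pt p.rep)).2)
  invFun q := SphereBundle.ofVec (c.symm q.1) (chartDSymm c q.1 (A.symm (1, q.2)))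
  source := {p | p.pt ∈ c.source ∧ 0 < (A (chartD c p.pt p.rep)).1}
  target := {q | q.1 ∈ c.target}
  map_source' p hp := c.map_source hp.1
  map_target' := by
    rintro ⟨a, z⟩ ha
    obtain ⟨r, hr, h⟩ := sphereChart_aux hc A ha z
    refine ⟨c.map_target ha, ?_⟩
    have h' : chartD c (c.symm a) (SphereBundle.ofVec (c.symm a)
      (chartDSymm c a (A.symm (1, z)))).rep = r • A.symm (1, z) := h
    show 0 < (A (chartD c (c.symm a) (SphereBundle.ofVec (c.symm a)
      (chartDSymm c a (A.symm (1, z)))).rep)).1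
    rw [h']
    simpa using hr
  left_inv' := by
    rintro p ⟨hp, ht⟩
    conv_rhs => rw [← SphereBundle.ofVec_rep p]
    refine SphereBundle.ofVec_congr (c.left_inv hp) (inv_pos.2 ht) ?_
    have h0 := chartDSymm_chartD hc hp p.rep
    set w := chartD c p.pt p.rep with hw
    have : A.symm (1, (A w).1⁻¹ • (A w).2) = (A w).1⁻¹ • w := by
      apply A.injective
      rw [A.apply_symm_apply, map_smul]
      ext1
      · simp [inv_mul_cancel₀ ht.ne']
      · simp
    rw [this, ← h0]
    exact map_smul (chartDSymm c (c p.pt)) _ w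
  right_inv' := by
    rintro ⟨a, z⟩ ha
    obtain ⟨r, hr, h⟩ := sphereChart_aux hc A ha z
    have h' : chartD c (c.symm a) (SphereBundle.ofVec (c.symm a)
      (chartDSymm c a (A.symm (1, z)))).rep = r • A.symm (1, z) := h
    show (c (c.symm a), (A (chartD c (c.symm a) (SphereBundle.ofVec (c.symm a)
      (chartDSymm c a (A.symm (1, z)))).rep)).1⁻¹ • (A (chartD c (c.symm a)
      (SphereBundle.ofVec (c.symm a) (chartDSymm c a (A.symm (1, z)))).rep)).2) = _
    rw [h', c.right_inv ha]
    simp [smul_smul, inv_mul_cancel₀ hr.ne']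

/-- The transition map between two charts of `SM`, written out. -/
theorem sphereChart_transition [IsManifold (𝓡 (m + 1)) ∞ M]
    {c c' : OpenPartialHomeomorph M (Vec (m + 1))}
    (hc : c ∈ IsManifold.maximalAtlas (𝓡 (m + 1)) ∞ M)
    (hc' : c' ∈ IsManifold.maximalAtlas (𝓡 (m + 1)) ∞ M) (A A' : Vec (m + 1) ≃L[ℝ] ℝ × Vec m) :
    ∃ f : Vec (m + 1) × Vec m → Vec (m + 1) × Vec m,
      IsOpen ((sphereChart c hc A).symm.trans (sphereChart c' hc' A')).source ∧
      ContDiffOn ℝ ∞ f ((sphereChart c hc A).symm.trans (sphereChart c' hc' A')).source ∧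
      EqOn ((sphereChart c hc A).symm.trans (sphereChart c' hc' A')) f
        ((sphereChart c hc A).symm.trans (sphereChart c' hc' A')).source := by
  set φ : Vec (m + 1) → Vec (m + 1) := c' ∘ c.symm with hφ
  set O : Set (Vec (m + 1)) := (c.symm.trans c').source with hO
  have hOo : IsOpen O := (c.symm.trans c').open_source
  have hOt : ∀ a ∈ O, a ∈ c.target ∧ c.symm a ∈ c'.source := by
    intro a ha
    simpa [hO, OpenPartialHomeomorph.trans_source] using ha
  have hφs : ContDiffOn ℝ ∞ φ O := by
    rw [← contMDiffOn_iff_contDiffOn]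
    exact (contMDiffOn_of_mem_maximalAtlas hc').comp
      ((contMDiffOn_symm_of_mem_maximalAtlas hc).mono fun a ha => (hOt a ha).1)
      fun a ha => (hOt a ha).2
  have hder : ∀ a ∈ O, ∀ w : Vec (m + 1),
      chartD c' (c.symm a) (chartDSymm c a w) = fderiv ℝ φ a w := by
    intro a ha w
    have h1 : mfderiv (𝓡 (m + 1)) (𝓡 (m + 1)) (c' ∘ c.symm) a = _ :=
      mfderiv_comp a ((chart_mdifferentiable hc').mdifferentiableAt (hOt a ha).2)
        ((chart_mdifferentiable hc).mdifferentiableAt_symm (hOt a ha).1)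
    rw [← mfderiv_eq_fderiv]
    exact (DFunLike.congr_fun h1 w).symm
  let g : Vec (m + 1) × Vec m → ℝ × Vec m := fun q => A' (fderiv ℝ φ q.1 (A.symm (1, q.2)))
  have hg : ContDiffOn ℝ ∞ g (O ×ˢ univ) := by
    refine A'.contDiff.comp_contDiffOn ?_
    have h1 : ContDiffOn ℝ ∞ (fun q : Vec (m + 1) × Vec m => fderiv ℝ φ q.1) (O ×ˢ univ) :=
      (hφs.fderiv_of_isOpen hOo (by simp)).comp contDiffOn_fst fun q hq => hq.1
    exact h1.clm_apply (A.symm.contDiff.comp (contDiff_const.prodMk contDiff_snd)).contDiffOn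
  have hsrc : ((sphereChart c hc A).symm.trans (sphereChart c' hc' A')).source =
      (O ×ˢ univ) ∩ g ⁻¹' {t | 0 < t.1} := by
    ext ⟨a, z⟩
    have key : a ∈ O → ((0 < (A' (chartD c' (c.symm a) (SphereBundle.ofVec (c.symm a)
        (chartDSymm c a (A.symm (1, z)))).rep)).1) ↔ 0 < (g (a, z)).1) := by
      intro ha
      obtain ⟨r, hr, h⟩ := sphereChart_aux' c c' hc A (hOt a ha).1 z
      rw [h, hder a ha, map_smul]
      exact mul_pos_iff_of_pos_left hr
    constructor
    · rintro ⟨ha, hs, ht⟩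
      have haO : a ∈ O := by
        rw [hO, OpenPartialHomeomorph.trans_source]
        exact ⟨ha, hs⟩
      exact ⟨⟨haO, mem_univ _⟩, (key haO).1 ht⟩
    · rintro ⟨⟨haO, -⟩, ht⟩
      exact ⟨(hOt a haO).1, (hOt a haO).2, (key haO).2 ht⟩
  have hopen : IsOpen ((O ×ˢ univ) ∩ g ⁻¹' {t : ℝ × Vec m | 0 < t.1}) :=
    hg.continuousOn.isOpen_inter_preimage (hOo.prod isOpen_univ)
      (isOpen_lt continuous_const continuous_fst)
  refine ⟨fun q => (φ q.1, (g q).1⁻¹ • (g q).2), hsrc ▸ hopen, ?_, ?_⟩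
  · rw [hsrc]
    have hg' := hg.mono (inter_subset_left (t := g ⁻¹' {t : ℝ × Vec m | 0 < t.1}))
    refine ContDiffOn.prodMk (hφs.comp contDiffOn_fst fun q hq => hq.1.1) ?_
    exact ((contDiff_fst.comp_contDiffOn hg').inv fun q hq => ne_of_gt hq.2).smul
      (contDiff_snd.comp_contDiffOn hg')
  · rintro ⟨a, z⟩ hq
    rw [hsrc] at hq
    have ha := hq.1.1
    obtain ⟨r, hr, h⟩ := sphereChart_aux' c c' hc A (hOt a ha).1 z
    show (c' (c.symm a), (A' (chartD c' (c.symm a) (SphereBundle.ofVec (c.symm a)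
      (chartDSymm c a (A.symm (1, z)))).rep)).1⁻¹ • (A' (chartD c' (c.symm a)
      (SphereBundle.ofVec (c.symm a) (chartDSymm c a (A.symm (1, z)))).rep)).2) = _
    rw [h, hder a ha, map_smul]
    refine Prod.ext rfl ?_
    simp only [g, Prod.smul_fst, Prod.smul_snd, smul_eq_mul, mul_inv, smul_smul]
    congr 1
    field_simp

variable [IsManifold (𝓡 (m + 1)) ∞ M]

theorem exists_linear_pos (w : Vec (m + 1)) (hw : w ≠ 0) :
    ∃ A : Vec (m + 1) ≃L[ℝ] ℝ × Vec m, 0 < (A w).1 := by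
  have A₀ : Vec (m + 1) ≃L[ℝ] ℝ × Vec m :=
    ContinuousLinearEquiv.ofFinrankEq (by simp [add_comm])
  have h1 : A₀.symm (1, 0) ≠ 0 := by
    intro h
    have := congrArg (fun v => (A₀ v).1) h
    simp at this
  obtain ⟨B, hB⟩ := SeparatingDual.exists_continuousLinearEquiv_apply_eq (R := ℝ) hw h1
  exact ⟨B.trans A₀, by simp [hB]⟩

theorem chartD_rep_ne_zero (p : SphereBundle m M) :
    chartD (chartAt (Vec (m + 1)) p.pt) p.pt p.rep ≠ 0 := by
  intro h
  have h1 := chartDSymm_chartD (IsManifold.chart_mem_maximalAtlas (I := 𝓡 (m + 1)) (n := ∞) p.pt)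
    (mem_chart_source _ p.pt) p.rep
  rw [h, map_zero] at h1
  exact p.rep_ne_zero h1.symm

variable (m M) in
/-- The smooth atlas of `SM` consisting of all the charts above. -/
def sphereCore : ChartedSpaceCore (Vec (m + 1) × Vec m) (SphereBundle m M) where
  atlas := {e | ∃ c hc A, e = sphereChart c hc A}
  chartAt p := sphereChart (chartAt (Vec (m + 1)) p.pt)
    (IsManifold.chart_mem_maximalAtlas p.pt) (exists_linear_pos _ (chartD_rep_ne_zero p)).choose
  mem_chart_source p := ⟨mem_chart_source _ p.pt,
    (exists_linear_pos _ (chartD_rep_ne_zero p)).choose_spec⟩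
  chart_mem_atlas p := ⟨_, _, _, rfl⟩
  open_source := by
    rintro _ _ ⟨c, hc, A, rfl⟩ ⟨c', hc', A', rfl⟩
    obtain ⟨f, h, -, -⟩ := sphereChart_transition hc hc' A A'
    exact h
  continuousOn_toFun := by
    rintro _ _ ⟨c, hc, A, rfl⟩ ⟨c', hc', A', rfl⟩
    obtain ⟨f, -, h, h'⟩ := sphereChart_transition hc hc' A A'
    exact h.continuousOn.congr h'

instance : TopologicalSpace (SphereBundle m M) := (sphereCore m M).toTopologicalSpace

instance : ChartedSpace (Vec (m + 1) × Vec m) (SphereBundle m M) := (sphereCore m M).toChartedSpace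

instance : IsManifold 𝓘(ℝ, Vec (m + 1) × Vec m) ∞ (SphereBundle m M) := by
  apply isManifold_of_contDiffOn
  intro e e' he he'
  have key : ∀ e ∈ atlas (Vec (m + 1) × Vec m) (SphereBundle m M),
      ∃ (e₀ : PartialEquiv (SphereBundle m M) (Vec (m + 1) × Vec m)) (h : e₀ ∈ (sphereCore m M).atlas),
        e = (sphereCore m M).openPartialHomeomorph e₀ h := by
    intro e he
    obtain ⟨e₀, he⟩ := mem_iUnion.1 he
    obtain ⟨h, he⟩ := mem_iUnion.1 he
    exact ⟨e₀, h, he⟩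
  obtain ⟨_, ⟨c, hc, A, rfl⟩, rfl⟩ := key e he
  obtain ⟨_, ⟨c', hc', A', rfl⟩, rfl⟩ := key e' he'
  obtain ⟨f, -, h, h'⟩ := sphereChart_transition hc hc' A A'
  refine (h.congr h').mono ?_
  rintro q ⟨hq, -⟩
  exact hq

end SphereBundle

section Connections

variable {E : Type*} [NormedAddCommGroup E] [NormedSpace ℝ E]
  {S : Type*} [TopologicalSpace S] [ChartedSpace E S] [IsManifold 𝓘(ℝ, E) ∞ S]

variable (E S) in
/-- Vector fields on a manifold `S` (not assumed smooth). -/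
abbrev VField := (p : S) → TangentSpace 𝓘(ℝ, E) p

/-- The vector field `X` is smooth on the set `W`. -/
def SmoothFieldOn (W : Set S) (X : VField E S) : Prop :=
  ContMDiffOn 𝓘(ℝ, E) 𝓘(ℝ, E).tangent ∞ (fun p => (⟨p, X p⟩ : TangentBundle 𝓘(ℝ, E) S)) W

/-- The derivative `X f` of a function along a vector field. -/
def dirDeriv (X : VField E S) (f : S → ℝ) (p : S) : ℝ :=
  mfderiv 𝓘(ℝ, E) 𝓘(ℝ, ℝ) f p (X p)

/-- `D` (with `D X Y = ∇_X Y`) is the Levi-Civita connection of the metric `g` on the open set `W`: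
it is an affine connection on `W` which is torsion free and preserves `g`. -/
structure IsLeviCivitaOn (W : Set S) (g : (p : S) → LinearMap.BilinForm ℝ (TangentSpace 𝓘(ℝ, E) p))
    (D : VField E S → VField E S → VField E S) : Prop where
  smooth : ∀ X Y, SmoothFieldOn W X → SmoothFieldOn W Y → SmoothFieldOn W (D X Y)
  add_left : ∀ X X' Y, SmoothFieldOn W X → SmoothFieldOn W X' → SmoothFieldOn W Y →
    ∀ p ∈ W, D (fun q => X q + X' q) Y p = D X Y p + D X' Y p
  smul_left : ∀ (f : S → ℝ) (X Y : VField E S), ContMDiffOn 𝓘(ℝ, E) 𝓘(ℝ, ℝ) ∞ f W →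
    SmoothFieldOn W X → SmoothFieldOn W Y →
    ∀ p ∈ W, D (fun q => f q • X q) Y p = f p • D X Y p
  add_right : ∀ X Y Y', SmoothFieldOn W X → SmoothFieldOn W Y → SmoothFieldOn W Y' →
    ∀ p ∈ W, D X (fun q => Y q + Y' q) p = D X Y p + D X Y' p
  leibniz : ∀ (f : S → ℝ) (X Y : VField E S), ContMDiffOn 𝓘(ℝ, E) 𝓘(ℝ, ℝ) ∞ f W →
    SmoothFieldOn W X → SmoothFieldOn W Y →
    ∀ p ∈ W, D X (fun q => f q • Y q) p = dirDeriv X f p • Y p + f p • D X Y p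
  torsion_free : ∀ X Y, SmoothFieldOn W X → SmoothFieldOn W Y →
    ∀ p ∈ W, D X Y p - D Y X p = VectorField.mlieBracket 𝓘(ℝ, E) X Y p
  metric : ∀ X Y Z, SmoothFieldOn W X → SmoothFieldOn W Y → SmoothFieldOn W Z →
    ∀ p ∈ W, dirDeriv X (fun q => g q (Y q) (Z q)) p = g p (D X Y p) (Z p) + g p (Y p) (D X Z p)

end Connections

section Coordinates

variable {n : ℕ}

/-- `∂f/∂xⁱ` for a function `f(x, y)` on (an open subset of) `ℝⁿ × ℝⁿ`. -/
def pdX (i : Fin n) (f : Vec n × Vec n → ℝ) (q : Vec n × Vec n) : ℝ :=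
  fderiv ℝ f q (EuclideanSpace.single i 1, 0)

/-- `∂f/∂yⁱ` for a function `f(x, y)` on (an open subset of) `ℝⁿ × ℝⁿ`. -/
def pdY (i : Fin n) (f : Vec n × Vec n → ℝ) (q : Vec n × Vec n) : ℝ :=
  fderiv ℝ f q (0, EuclideanSpace.single i 1)

/-- The matrix `g_ij = ½ [L²]_{yⁱ yʲ}`, where `L(x, y)` is the coordinate expression of the Finsler
structure. -/
def fundMatrix (L : Vec n × Vec n → ℝ) (q : Vec n × Vec n) : Matrix (Fin n) (Fin n) ℝ :=
  Matrix.of fun i j => 1 / 2 * pdY j (pdY i fun r => L r ^ 2) q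

/-- The coefficients `Gⁱ = ¼ gⁱʲ ([L²]_{yʲ xᵏ} yᵏ - [L²]_{xʲ})`. -/
def sprayCoeff (L : Vec n × Vec n → ℝ) (i : Fin n) (q : Vec n × Vec n) : ℝ :=
  1 / 4 * ∑ j, (fundMatrix L q)⁻¹ i j *
    (∑ k, pdX k (pdY j fun r => L r ^ 2) q * q.2 k - pdX j (fun r => L r ^ 2) q)

/-- The coordinate vector fields `δ/δxⁱ = ∂/∂xⁱ - (∂Gʲ/∂yⁱ) ∂/∂yʲ`. -/
def deltaX (L : Vec n × Vec n → ℝ) (i : Fin n) (q : Vec n × Vec n) : Vec n × Vec n :=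
  (EuclideanSpace.single i 1,
    -∑ j, pdY i (sprayCoeff L j) q • EuclideanSpace.single j (1 : ℝ))

/-- The coordinate vector fields `δ/δyⁱ = L ∂/∂yⁱ`. -/
def deltaY (L : Vec n × Vec n → ℝ) (i : Fin n) (q : Vec n × Vec n) : Vec n × Vec n :=
  (0, L q • EuclideanSpace.single i 1)

/-- The one form `δxⁱ = dxⁱ`. -/
def coDeltaX (i : Fin n) : Vec n × Vec n →L[ℝ] ℝ :=
  (EuclideanSpace.proj i : Vec n →L[ℝ] ℝ) ∘L ContinuousLinearMap.fst ℝ (Vec n) (Vec n)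

/-- The one form `δyⁱ = L⁻¹ (dyⁱ + (∂Gⁱ/∂yʲ) dxʲ)`. -/
def coDeltaY (L : Vec n × Vec n → ℝ) (i : Fin n) (q : Vec n × Vec n) : Vec n × Vec n →L[ℝ] ℝ :=
  (L q)⁻¹ • ((EuclideanSpace.proj i : Vec n →L[ℝ] ℝ) ∘L ContinuousLinearMap.snd ℝ (Vec n) (Vec n) +
    ∑ j, pdY j (sprayCoeff L i) q • coDeltaX j)

/-- The almost complex structure `J` with `J (δ/δxⁱ) = δ/δyⁱ` and `J (δ/δyⁱ) = -δ/δxⁱ`. -/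
def almostJ (L : Vec n × Vec n → ℝ) (q : Vec n × Vec n) : Vec n × Vec n →L[ℝ] Vec n × Vec n :=
  ∑ i, ((coDeltaX i).smulRight (deltaY L i q) - (coDeltaY L i q).smulRight (deltaX L i q))

end Coordinates

section Finsler

variable {m : ℕ} {M : Type*} [TopologicalSpace M] [ChartedSpace (Vec (m + 1)) M]

/-- The coordinate expression `F(x, y)` of a function on `TM` in the coordinates of a chart `c`. -/
def coordF (F : TangentBundle (𝓡 (m + 1)) M → ℝ) (c : OpenPartialHomeomorph M (Vec (m + 1))) :
    Vec (m + 1) × Vec (m + 1) → ℝ :=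
  fun q => F ⟨c.symm q.1, chartDSymm c q.1 q.2⟩

/-- `F` is a Finsler structure: a positive smooth function on `TM₀ = TM ∖ 0`, positively homogeneous
of degree one, whose Hessian matrix `g_ij` is positive definite in all coordinates (the values of
`F` on the zero section play no role). -/
structure IsFinsler [IsManifold (𝓡 (m + 1)) ∞ M] (F : TangentBundle (𝓡 (m + 1)) M → ℝ) : Prop where
  smooth : ContMDiffOn (𝓡 (m + 1)).tangent 𝓘(ℝ, ℝ) ∞ F {v | v.2 ≠ 0}
  pos : ∀ v : TangentBundle (𝓡 (m + 1)) M, v.2 ≠ 0 → 0 < F v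
  homogeneous : ∀ (x : M) (y : TangentSpace (𝓡 (m + 1)) x) (r : ℝ), y ≠ 0 → 0 < r →
    F ⟨x, r • y⟩ = r * F ⟨x, y⟩
  posDef : ∀ c ∈ IsManifold.maximalAtlas (𝓡 (m + 1)) ∞ M, ∀ a ∈ c.target,
    ∀ y : Vec (m + 1), y ≠ 0 → (fundMatrix (coordF F c) (a, y)).PosDef

/-- The distinguished section `l(x, [y]) = y / F(x, y)` of `π^*TM` over `SM`. -/
def tautSection (F : TangentBundle (𝓡 (m + 1)) M → ℝ) (p : SphereBundle m M) :
    TangentSpace (𝓡 (m + 1)) p.pt :=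
  (F ⟨p.pt, p.rep⟩)⁻¹ • p.rep

/-- The section `l`, regarded as a section of the quotient map `TM₀ → SM`, in the coordinates
`(x, y)` of a chart `c`. -/
def tautCoord (F : TangentBundle (𝓡 (m + 1)) M → ℝ) (c : OpenPartialHomeomorph M (Vec (m + 1)))
    (p : SphereBundle m M) : Vec (m + 1) × Vec (m + 1) :=
  (c p.pt, chartD c p.pt (tautSection F p))

variable (m M) in
/-- Families of sections `e₁, …, eₙ` of `π^*TM` over `SM` (here `n = m + 1`, and the last index of
`Fin (m + 1)` stands for `n`). -/
abbrev PullbackFrame := Fin (m + 1) → (p : SphereBundle m M) → TangentSpace (𝓡 (m + 1)) p.pt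

/-- The matrix `(vⁱ_j)` with `ωⁱ = vⁱ_j dxʲ`, the inverse of the matrix `(uʲ_i)` of components
`e_i = uʲ_i ∂/∂xʲ`. -/
def coframeMatrix (c : OpenPartialHomeomorph M (Vec (m + 1))) (e : PullbackFrame m M)
    (p : SphereBundle m M) : Matrix (Fin (m + 1)) (Fin (m + 1)) ℝ :=
  (Matrix.of fun j i => chartD c p.pt (e i p) j)⁻¹

/-- The one form `ωⁱ = vⁱ_j dxʲ` on `TM₀`, in coordinates, at the points over `p ∈ SM`. -/
def omegaLift (c : OpenPartialHomeomorph M (Vec (m + 1))) (e : PullbackFrame m M)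
    (i : Fin (m + 1)) (p : SphereBundle m M) : Vec (m + 1) × Vec (m + 1) →L[ℝ] ℝ :=
  ∑ j, coframeMatrix c e p i j • coDeltaX j

variable [IsManifold (𝓡 (m + 1)) ∞ M]

/-- The frame `e` is a smooth orthonormal frame of `(π^*TM, g)` over `W` with `e_n = l`. (The `g_ij`
are homogeneous of degree zero in `y`, so they may be evaluated at `y = l`.) -/
structure IsAdaptedFrame (F : TangentBundle (𝓡 (m + 1)) M → ℝ)
    (c : OpenPartialHomeomorph M (Vec (m + 1))) (W : Set (SphereBundle m M))
    (e : PullbackFrame m M) : Prop where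
  smooth : ∀ i, ContMDiffOn 𝓘(ℝ, Vec (m + 1) × Vec m) (𝓡 (m + 1)).tangent ∞
    (fun p => (⟨p.pt, e i p⟩ : TangentBundle (𝓡 (m + 1)) M)) W
  orthonormal : ∀ p ∈ W, ∀ i j,
    ∑ k, ∑ l, fundMatrix (coordF F c) (tautCoord F c p) k l *
      chartD c p.pt (e i p) k * chartD c p.pt (e j p) l = if i = j then 1 else 0
  last_eq : ∀ p ∈ W, e (Fin.last m) p = tautSection F p

/-- The differential of the section `l : SM → TM₀`, in coordinates. -/
def tautD (F : TangentBundle (𝓡 (m + 1)) M → ℝ) (c : OpenPartialHomeomorph M (Vec (m + 1)))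
    (p : SphereBundle m M) :
    TangentSpace 𝓘(ℝ, Vec (m + 1) × Vec m) p →L[ℝ] Vec (m + 1) × Vec (m + 1) :=
  mfderiv 𝓘(ℝ, Vec (m + 1) × Vec m) 𝓘(ℝ, Vec (m + 1) × Vec (m + 1)) (tautCoord F c) p

/-- The coframe `θ = {ω¹, …, ωⁿ, ωⁿ⁺¹, …, ω²ⁿ⁻¹}` of `SM`: `Sum.inl i` stands for the index `i` and
`Sum.inr α` for `n + α`, where `ω^{n+α} = J^* ω^α`. The forms `ωⁱ` and `J^* ω^α` on `TM₀` are the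
pullbacks of forms on `SM` under the quotient map `TM₀ → SM`; these forms on `SM` are obtained by
pulling back along its section `l`. -/
def coframe (F : TangentBundle (𝓡 (m + 1)) M → ℝ) (c : OpenPartialHomeomorph M (Vec (m + 1)))
    (e : PullbackFrame m M) : Fin (m + 1) ⊕ Fin m → (p : SphereBundle m M) →
      TangentSpace 𝓘(ℝ, Vec (m + 1) × Vec m) p →L[ℝ] ℝ
  | Sum.inl i, p => omegaLift c e i p ∘L tautD F c p
  | Sum.inr α, p =>
    (omegaLift c e α.castSucc p ∘L almostJ (coordF F c) (tautCoord F c p)) ∘L tautD F c p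

/-- The Sasaki-type metric `∑ ωⁱ ⊗ ωⁱ + ∑ ω^{n+α} ⊗ ω^{n+α}` determined by a coframe `θ` of `SM`. -/
def sasakiMetric (θ : Fin (m + 1) ⊕ Fin m → (p : SphereBundle m M) →
      TangentSpace 𝓘(ℝ, Vec (m + 1) × Vec m) p →L[ℝ] ℝ) (p : SphereBundle m M) :
    LinearMap.BilinForm ℝ (TangentSpace 𝓘(ℝ, Vec (m + 1) × Vec m) p) :=
  ∑ a, LinearMap.BilinForm.linMulLin (θ a p).toLinearMap (θ a p).toLinearMap

/-- The vector fields `E a` form the (smooth) frame over `W` dual to the coframe `θ`. -/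
structure IsDualFrame (W : Set (SphereBundle m M))
    (θ : Fin (m + 1) ⊕ Fin m → (p : SphereBundle m M) →
      TangentSpace 𝓘(ℝ, Vec (m + 1) × Vec m) p →L[ℝ] ℝ)
    (E : Fin (m + 1) ⊕ Fin m → VField (Vec (m + 1) × Vec m) (SphereBundle m M)) : Prop where
  smooth : ∀ a, SmoothFieldOn W (E a)
  dual : ∀ p ∈ W, ∀ a b, θ b p (E a p) = if b = a then 1 else 0

/-- The vertical tangent space `V(SM)_p`, the kernel of `dπ`. -/
def vertical (p : SphereBundle m M) :
    Submodule ℝ (TangentSpace 𝓘(ℝ, Vec (m + 1) × Vec m) p) :=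
  LinearMap.ker (mfderiv 𝓘(ℝ, Vec (m + 1) × Vec m) (𝓡 (m + 1))
    (SphereBundle.pt : SphereBundle m M → M) p).toLinearMap

/-- The horizontal tangent space `H(SM)_p`, the orthogonal complement of `V(SM)_p` with respect to
the metric `g`. -/
def horizontal (g : (p : SphereBundle m M) →
      LinearMap.BilinForm ℝ (TangentSpace 𝓘(ℝ, Vec (m + 1) × Vec m) p)) (p : SphereBundle m M) :
    Submodule ℝ (TangentSpace 𝓘(ℝ, Vec (m + 1) × Vec m) p) :=
  (g p).orthogonal (vertical p)

/-- The orthogonal projection `p^⊥` of `T(SM)` onto `H(SM)`: the value is the unique `U ∈ H(SM)_p`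
with `X - U ∈ V(SM)_p`. -/
def horProj (g : (p : SphereBundle m M) →
      LinearMap.BilinForm ℝ (TangentSpace 𝓘(ℝ, Vec (m + 1) × Vec m) p)) (p : SphereBundle m M)
    (X : TangentSpace 𝓘(ℝ, Vec (m + 1) × Vec m) p) :
    TangentSpace 𝓘(ℝ, Vec (m + 1) × Vec m) p :=
  Classical.epsilon fun U => U ∈ horizontal g p ∧ X - U ∈ vertical p

/-- The Bott connection on `H(SM)` (for the metric `g` with Levi-Civita connection `D`):
`p^⊥ [X, U]` for vertical `X` and `p^⊥ ∇_X U` for horizontal `X`; a general `X` is split into its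
vertical and horizontal parts. -/
def bott (g : (p : SphereBundle m M) →
      LinearMap.BilinForm ℝ (TangentSpace 𝓘(ℝ, Vec (m + 1) × Vec m) p))
    (D : VField (Vec (m + 1) × Vec m) (SphereBundle m M) →
      VField (Vec (m + 1) × Vec m) (SphereBundle m M) →
      VField (Vec (m + 1) × Vec m) (SphereBundle m M))
    (X U : VField (Vec (m + 1) × Vec m) (SphereBundle m M)) :
    VField (Vec (m + 1) × Vec m) (SphereBundle m M) := fun p =>
  horProj g p (VectorField.mlieBracket 𝓘(ℝ, Vec (m + 1) × Vec m)
      (fun q => X q - horProj g q (X q)) U p) +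
    horProj g p (D (fun q => horProj g q (X q)) U p)

/-- The one forms `Γ i j` (standing for `ω_iʲ`) are the connection forms over `W` of the connection
`B` on `H(SM)` in the frame `E₁, …, Eₙ`: `B_X E_i = ω_iʲ(X) E_j`. -/
def IsConnectionMatrix (W : Set (SphereBundle m M))
    (B : VField (Vec (m + 1) × Vec m) (SphereBundle m M) →
      VField (Vec (m + 1) × Vec m) (SphereBundle m M) →
      VField (Vec (m + 1) × Vec m) (SphereBundle m M))
    (E : Fin (m + 1) → VField (Vec (m + 1) × Vec m) (SphereBundle m M))
    (Γ : Fin (m + 1) → Fin (m + 1) → (p : SphereBundle m M) →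
      TangentSpace 𝓘(ℝ, Vec (m + 1) × Vec m) p →L[ℝ] ℝ) : Prop :=
  ∀ X, SmoothFieldOn W X → ∀ p ∈ W, ∀ i, B X (E i) p = ∑ j, Γ i j p (X p) • E j p

end Finsler

end

/-!
Everything is read along the section `l : SM → TM₀`, in coordinates `τ = (x, y)` of `TM₀`. Its image is
the indicatrix bundle `F = 1`. In these terms the frame dual to `ω¹, …, ω²ⁿ⁻¹` is simple
(`isMovingFrame`): the differential of `l` sends `𝐞_i` to the horizontal lift `u_i - N u_i` of
`e_i = u_i ∂/∂x`, where `N = ∂G/∂y`, and `𝐞_{n+α}` to the vertical vector `-u_α`. That no further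
component along `l` appears is the fact `δF/δx = 0` together with `F = 1`.

The Bott connection of a vertical `X` has the coefficients `ωʲ([X, 𝐞_i])`, that of a horizontal `X` the
Levi-Civita coefficients `⟨∇_X 𝐞_i, 𝐞_j⟩`, and `bott_eq_sum` shows that they are tensorial in `X`. The
connection forms are therefore determined by the brackets of the frame, and only the projections
of these brackets to `M` matter. The projection of `[X, Y]` is `X (Y x) - Y (X x)` (`lieD_mlieBracket`),
so that it is expressed by derivatives of the components `u_i`; differentiating the relations
`g(u_i, u_j) = δ_ij` then leaves derivatives of `g` and of the Hilbert form `ωⁿ = g(l, dx)` only.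

* In vertical directions, `ωⁿ([𝐞_{n+β}, 𝐞_i]) = δ_{βi}` and `[𝐞_{n+β}, 𝐞_n]` projects to `-e_β`, which are
  the asserted values (`hilbert_bracket_vertical`, `bracket_vertical_reeb`).
* In horizontal directions, the Koszul formula shows that all `⟨∇_{𝐞_k} 𝐞_i, 𝐞_n⟩` vanish
  (`coframe_last_leviCivita`), because `ωⁿ([𝐞_k, 𝐞_i]) = 0` and `ωʲ([𝐞_n, 𝐞_i])` is antisymmetric in `i, j`.

The last two facts express the symmetry of horizontal derivatives of the Hilbert form and the
parallelism of `g` along the geodesic spray. Both follow by differentiating the equation of the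
spray once in a vertical direction and using Euler's identities (`IsSpray.horizontal_symm`,
`IsSpray.fundamental_parallel`).
-/

/-! ### The Lie bracket as a commutator of derivations -/

section Bracket

variable {E : Type*} [NormedAddCommGroup E] [NormedSpace ℝ E] [CompleteSpace E]
  {G : Type*} [NormedAddCommGroup G] [NormedSpace ℝ G]
  {S : Type*} [TopologicalSpace S] [ChartedSpace E S] [IsManifold 𝓘(ℝ, E) ∞ S]

/-- The derivative `X f` of a vector-valued function `f` along a vector field `X`. -/
noncomputable def lieD (f : S → G) (X : VField E S) (q : S) : G := mfderiv 𝓘(ℝ, E) 𝓘(ℝ, G) f q (X q)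

/-- `[X, Y] f = X (Y f) - Y (X f)` on a manifold. All three derivatives are read in the preferred
chart at `p`, where the identity is the one for vector fields on a vector space. -/
theorem lieD_mlieBracket {f : S → G} {X Y : VField E S} {p : S}
    (hf : ContMDiffAt 𝓘(ℝ, E) 𝓘(ℝ, G) 2 f p)
    (hX : MDifferentiableAt 𝓘(ℝ, E) 𝓘(ℝ, E).tangent
      (fun q => (⟨q, X q⟩ : TangentBundle 𝓘(ℝ, E) S)) p)
    (hY : MDifferentiableAt 𝓘(ℝ, E) 𝓘(ℝ, E).tangent
      (fun q => (⟨q, Y q⟩ : TangentBundle 𝓘(ℝ, E) S)) p) :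
    lieD f (VectorField.mlieBracket 𝓘(ℝ, E) X Y) p =
      lieD (lieD f Y) X p - lieD (lieD f X) Y p := by
  have : IsManifold 𝓘(ℝ, E) 2 S := inferInstance
  have : IsManifold 𝓘(ℝ, E) 1 S := inferInstance
  have hr : range 𝓘(ℝ, E) = univ := by simp
  set φ := extChartAt 𝓘(ℝ, E) p with hφ
  set fh : E → G := f ∘ φ.symm with hfh
  let pb : VField E S → E → E := fun Z a =>
    (mfderiv 𝓘(ℝ, E) 𝓘(ℝ, E) φ.symm a).inverse (Z (φ.symm a))
  have hpbd : ∀ Z : VField E S, MDifferentiableAt 𝓘(ℝ, E) 𝓘(ℝ, E).tangent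
      (fun q => (⟨q, Z q⟩ : TangentBundle 𝓘(ℝ, E) S)) p → DifferentiableAt ℝ (pb Z) (φ p) := by
    intro Z hZ
    have := MDifferentiableWithinAt.differentiableWithinAt_mpullbackWithin_vectorField
      (hZ.mdifferentiableWithinAt (s := univ))
    rw [hr, preimage_univ, inter_univ, VectorField.mpullbackWithin_univ] at this
    exact differentiableWithinAt_univ.1 this
  have hfC : ContDiffAt ℝ 2 fh (φ p) := by
    have := (contMDiffAt_iff.1 hf).2
    rw [hr, contDiffWithinAt_univ] at this
    exact this
  have hsymmd : ∀ a ∈ φ.target, MDifferentiableAt 𝓘(ℝ, E) 𝓘(ℝ, E) φ.symm a := fun a ha => by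
    have := mdifferentiableWithinAt_extChartAt_symm (I := 𝓘(ℝ, E)) ha
    rwa [hr, mdifferentiableWithinAt_univ] at this
  have htn : φ.target ∈ 𝓝 (φ p) := extChartAt_target_mem_nhds (I := 𝓘(ℝ, E)) p
  have hsn : φ.source ∈ 𝓝 p := extChartAt_source_mem_nhds (I := 𝓘(ℝ, E)) p
  have hinv : ∀ a ∈ φ.target, (mfderiv 𝓘(ℝ, E) 𝓘(ℝ, E) φ.symm a).IsInvertible := fun a ha => by
    have := isInvertible_mfderivWithin_extChartAt_symm (I := 𝓘(ℝ, E)) ha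
    rwa [hr, mfderivWithin_univ] at this
  have hfev : ∀ᶠ a in 𝓝 (φ p), MDifferentiableAt 𝓘(ℝ, E) 𝓘(ℝ, G) f (φ.symm a) := by
    have h1 : ∀ᶠ q in 𝓝 p, ContMDiffAt 𝓘(ℝ, E) 𝓘(ℝ, G) 2 f q :=
      (contMDiffAt_iff_contMDiffAt_nhds (by simp)).1 hf
    have h2 : Tendsto φ.symm (𝓝 (φ p)) (𝓝 p) := by
      have := (continuousAt_extChartAt_symm (I := 𝓘(ℝ, E)) p).tendsto
      rwa [extChartAt_to_inv] at this
    exact (h2.eventually h1).mono fun a ha => ha.mdifferentiableAt (by simp)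
  have hkey : ∀ Z : VField E S, (fun a => lieD f Z (φ.symm a)) =ᶠ[𝓝 (φ p)]
      fun a => fderiv ℝ fh a (pb Z a) := by
    intro Z
    filter_upwards [hfev, htn] with a ha hat
    have hc := mfderiv_comp (I := 𝓘(ℝ, E)) (I' := 𝓘(ℝ, E)) (I'' := 𝓘(ℝ, G)) a ha (hsymmd a hat)
    rw [← mfderiv_eq_fderiv, hfh, hc]
    exact congrArg (mfderiv 𝓘(ℝ, E) 𝓘(ℝ, G) f (φ.symm a))
      ((hinv a hat).self_apply_inverse _).symm
  have hpb : ∀ Z : VField E S, pb Z (φ p) = mfderiv 𝓘(ℝ, E) 𝓘(ℝ, E) φ p (Z p) := by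
    intro Z
    have h1 := mfderivWithin_extChartAt_symm_comp_mfderiv_extChartAt' (I := 𝓘(ℝ, E))
      (mem_extChartAt_source (I := 𝓘(ℝ, E)) p)
    rw [hr, mfderivWithin_univ] at h1
    have h2 : ∀ q : S, q = p → ∀ v : TangentSpace 𝓘(ℝ, E) p, (v : E) = Z q →
      (mfderiv 𝓘(ℝ, E) 𝓘(ℝ, E) φ.symm (φ p)).inverse v = mfderiv 𝓘(ℝ, E) 𝓘(ℝ, E) φ p (Z p) := by
      rintro q rfl v hv
      have h3 := DFunLike.congr_fun h1 v
      have h4 : v = Z q := hv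
      rw [← h4]
      conv_lhs => rw [← show _ = v from h3]
      exact (hinv _ (mem_extChartAt_target q)).inverse_apply_self _
    exact h2 _ (extChartAt_to_inv (I := 𝓘(ℝ, E)) p) _ rfl
  have hchain : ∀ h : S → G, DifferentiableAt ℝ (h ∘ φ.symm) (φ p) → ∀ v : TangentSpace 𝓘(ℝ, E) p,
      mfderiv 𝓘(ℝ, E) 𝓘(ℝ, G) h p v =
        fderiv ℝ (h ∘ φ.symm) (φ p) (mfderiv 𝓘(ℝ, E) 𝓘(ℝ, E) φ p v) := by
    intro h hh v
    have h1 : h =ᶠ[𝓝 p] (h ∘ φ.symm) ∘ φ := by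
      filter_upwards [hsn] with q hq
      simp only [Function.comp_apply, φ.left_inv hq]
    rw [h1.mfderiv_eq, mfderiv_comp (I' := 𝓘(ℝ, E)) p hh.mdifferentiableAt
      (mdifferentiableAt_extChartAt (mem_chart_source E p)), mfderiv_eq_fderiv]
    rfl
  have hlie : ∀ Y Z : VField E S, MDifferentiableAt 𝓘(ℝ, E) 𝓘(ℝ, E).tangent
      (fun q => (⟨q, Z q⟩ : TangentBundle 𝓘(ℝ, E) S)) p → lieD (lieD f Z) Y p =
        fderiv ℝ (fun a => fderiv ℝ fh a (pb Z a)) (φ p) (pb Y (φ p)) := by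
    intro Y Z hZ
    have hd : DifferentiableAt ℝ (fun a => fderiv ℝ fh a (pb Z a)) (φ p) :=
      ((hfC.fderiv_right (m := 1) (by norm_num)).differentiableAt (by simp)).clm_apply (hpbd Z hZ)
    have h1 : (lieD f Z ∘ φ.symm) =ᶠ[𝓝 (φ p)] fun a => fderiv ℝ fh a (pb Z a) := hkey Z
    rw [hpb, ← h1.fderiv_eq]
    exact hchain (lieD f Z) (hd.congr_of_eventuallyEq h1) _
  rw [hlie X Y hY, hlie Y X hX, ← VectorField.fderiv_apply_lieBracket hfC (by simp) (hpbd Y hY)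
    (hpbd X hX)]
  refine (hchain f (hfC.differentiableAt (by simp)) _).trans ?_
  refine congrArg (fderiv ℝ fh (φ p)) ?_
  set b : E := VectorField.lieBracket ℝ (pb X) (pb Y) (φ p) with hb
  have h5 : VectorField.mlieBracket 𝓘(ℝ, E) X Y p =
      (mfderiv 𝓘(ℝ, E) 𝓘(ℝ, E) φ p).inverse b := by
    rw [← VectorField.mlieBracketWithin_univ, VectorField.mlieBracketWithin_apply]
    rw [hr, preimage_univ, inter_univ, VectorField.mpullbackWithin_univ,
      VectorField.mpullbackWithin_univ]
    exact congrArg (mfderiv 𝓘(ℝ, E) 𝓘(ℝ, E) φ p).inverse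
      (congrFun VectorField.lieBracketWithin_univ (φ p))
  rw [h5]
  exact (isInvertible_mfderiv_extChartAt (mem_extChartAt_source p)).self_apply_inverse _

end Bracket

/-! ### Second order identities for a geodesic spray -/

section Spray

variable {V : Type*} [NormedAddCommGroup V] [NormedSpace ℝ V]

/-- The vector-valued function `G` on the open set `Ω ⊆ V × V` (points `(x, y)`) is the geodesic spray
of the smooth function `A = L²`, where `A` is homogeneous of degree two in `y` (in the form of Euler's
identity) and its vertical Hessian `2 g` is nondegenerate. The equation for `G` is
`4 g_ij Gʲ = [A]_{yⁱ xᵏ} yᵏ - [A]_{xⁱ}`, paired with a vector `w`. Vertical vectors are written `(0, w)`,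
and `N = ∂G/∂y` is `fderiv ℝ G q (0, ·)`. -/
structure IsSpray (A : V × V → ℝ) (Ω : Set (V × V)) (G : V × V → V) : Prop where
  isOpen : IsOpen Ω
  smooth : ContDiffOn ℝ ∞ A Ω
  spray_differentiable : ∀ q ∈ Ω, DifferentiableAt ℝ G q
  euler : ∀ q ∈ Ω, fderiv ℝ A q (0, q.2) = 2 * A q
  nondegenerate : ∀ q ∈ Ω, ∀ v : V,
    (∀ w, fderiv ℝ (fderiv ℝ A) q (0, w) (0, v) = 0) → v = 0
  spray_eq : ∀ q ∈ Ω, ∀ w : V, 2 * fderiv ℝ (fderiv ℝ A) q (0, w) (0, G q) =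
    fderiv ℝ (fderiv ℝ A) q (q.2, 0) (0, w) - fderiv ℝ A q (w, 0)

namespace IsSpray

variable {A : V × V → ℝ} {Ω : Set (V × V)} {G : V × V → V}

local notation "A₁" => fderiv ℝ A
local notation "A₂" => fderiv ℝ (fderiv ℝ A)
local notation "A₃" => fderiv ℝ (fderiv ℝ (fderiv ℝ A))

section
variable (h : IsSpray A Ω G)
include h

theorem contDiffOn_fderiv : ContDiffOn ℝ ∞ A₁ Ω := h.smooth.fderiv_of_isOpen h.isOpen (by simp)

theorem contDiffOn_fderiv_fderiv : ContDiffOn ℝ ∞ A₂ Ω :=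
  h.contDiffOn_fderiv.fderiv_of_isOpen h.isOpen (by simp)

theorem hasFDerivAt₀ {q : V × V} (hq : q ∈ Ω) : HasFDerivAt A (A₁ q) q :=
  ((h.smooth.contDiffAt (h.isOpen.mem_nhds hq)).differentiableAt (by simp)).hasFDerivAt

theorem hasFDerivAt₁ {q : V × V} (hq : q ∈ Ω) : HasFDerivAt A₁ (A₂ q) q :=
  ((h.contDiffOn_fderiv.contDiffAt (h.isOpen.mem_nhds hq)).differentiableAt (by simp)).hasFDerivAt

theorem hasFDerivAt₂ {q : V × V} (hq : q ∈ Ω) : HasFDerivAt A₂ (A₃ q) q :=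
  ((h.contDiffOn_fderiv_fderiv.contDiffAt (h.isOpen.mem_nhds hq)).differentiableAt
    (by simp)).hasFDerivAt

theorem symm₂ {q : V × V} (hq : q ∈ Ω) (a b : V × V) : A₂ q a b = A₂ q b a :=
  (h.smooth.contDiffAt (h.isOpen.mem_nhds hq)).isSymmSndFDerivAt (by simpa using ENat.LEInfty.out) a b

theorem symm₃ {q : V × V} (hq : q ∈ Ω) (a b d : V × V) : A₃ q a b d = A₃ q b a d :=
  congrArg (fun T : V × V →L[ℝ] ℝ => T d)
    ((h.contDiffOn_fderiv.contDiffAt (h.isOpen.mem_nhds hq)).isSymmSndFDerivAt (by simpa using ENat.LEInfty.out) a b)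

/-- The third derivative is also symmetric in its last two arguments: the symmetric second derivative
is differentiated. -/
theorem symm₃' {q : V × V} (hq : q ∈ Ω) (a b d : V × V) : A₃ q a b d = A₃ q a d b := by
  have h1 : ∀ b d, HasFDerivAt (fun r => A₂ r b d)
      (((A₃ q).flip b).flip d) q := fun b d => by
    have := ((h.hasFDerivAt₂ hq).clm_apply (hasFDerivAt_const b q)).clm_apply (hasFDerivAt_const d q)
    convert! this using 1
    ext <;> simp
  have h2 : (fun r => A₂ r b d) =ᶠ[𝓝 q] fun r => A₂ r d b := by
    filter_upwards [h.isOpen.mem_nhds hq] with r hr using h.symm₂ hr b d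
  exact congrArg (fun T : V × V →L[ℝ] ℝ => T a)
    (((h1 b d).congr_of_eventuallyEq h2.symm).unique (h1 d b))

omit h in
theorem hasFDerivAt_vert (q : V × V) : HasFDerivAt (fun r : V × V => ((0 : V), r.2))
    ((ContinuousLinearMap.inr ℝ V V).comp (ContinuousLinearMap.snd ℝ V V)) q :=
  ((ContinuousLinearMap.inr ℝ V V).comp (ContinuousLinearMap.snd ℝ V V)).hasFDerivAt

/-- Euler's identity for the first derivatives of `A`. -/
theorem euler₁ {q : V × V} (hq : q ∈ Ω) (a : V × V) :
    A₂ q a (0, q.2) = 2 * A₁ q a - A₁ q (0, a.2) := by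
  have h1 := (h.hasFDerivAt₁ hq).clm_apply (hasFDerivAt_vert q)
  have h2 := (h.hasFDerivAt₀ hq).const_mul 2
  have h3 : (fun r : V × V => A₁ r (0, r.2)) =ᶠ[𝓝 q] fun r => 2 * A r := by
    filter_upwards [h.isOpen.mem_nhds hq] with r hr using h.euler r hr
  have h4 := congrArg (fun T : V × V →L[ℝ] ℝ => T a) ((h1.congr_of_eventuallyEq h3.symm).unique h2)
  simp at h4
  linarith

/-- Euler's identity for the second derivatives of `A`. -/
theorem euler₂ {q : V × V} (hq : q ∈ Ω) (a b : V × V) :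
    A₃ q b a (0, q.2) = 2 * A₂ q b a - A₂ q b (0, a.2) - A₂ q a (0, b.2) := by
  have h1 := ((h.hasFDerivAt₂ hq).clm_apply (hasFDerivAt_const a q)).clm_apply (hasFDerivAt_vert q)
  have h2 := (((h.hasFDerivAt₁ hq).clm_apply (hasFDerivAt_const a q)).const_mul 2).sub
    ((h.hasFDerivAt₁ hq).clm_apply (hasFDerivAt_const ((0 : V), a.2) q))
  have h3 : (fun r : V × V => A₂ r a (0, r.2)) =ᶠ[𝓝 q] fun r => 2 * A₁ r a - A₁ r (0, a.2) := by
    filter_upwards [h.isOpen.mem_nhds hq] with r hr using h.euler₁ hr a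
  have h4 := congrArg (fun T : V × V →L[ℝ] ℝ => T b) ((h1.congr_of_eventuallyEq h3.symm).unique h2)
  simp at h4
  linarith

/-- The vertical derivative of the equation that defines the spray. All the identities between
`g`, `N` and `G` below follow from it and from Euler's identities. -/
theorem spray_eq₁ {q : V × V} (hq : q ∈ Ω) (u w : V) :
    2 * A₂ q (0, w) (0, fderiv ℝ G q (0, u)) = A₃ q (0, u) (q.2, 0) (0, w)
      - 2 * A₃ q (0, u) (0, w) (0, G q) + A₂ q (u, 0) (0, w) - A₂ q (0, u) (w, 0) := by
  have hG := (h.spray_differentiable q hq).hasFDerivAt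
  have h1 := (((h.hasFDerivAt₂ hq).clm_apply (hasFDerivAt_const ((0 : V), w) q)).clm_apply
    ((ContinuousLinearMap.inr ℝ V V).hasFDerivAt.comp q hG)).const_mul 2
  have h2 := (((h.hasFDerivAt₂ hq).clm_apply (((ContinuousLinearMap.inl ℝ V V).comp
    (ContinuousLinearMap.snd ℝ V V)).hasFDerivAt (x := q))).clm_apply
    (hasFDerivAt_const ((0 : V), w) q)).sub
    ((h.hasFDerivAt₁ hq).clm_apply (hasFDerivAt_const (w, (0 : V)) q))
  have h3 : (fun r : V × V => 2 * A₂ r (0, w) (0, G r)) =ᶠ[𝓝 q]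
      fun r => A₂ r (r.2, 0) (0, w) - A₁ r (w, 0) := by
    filter_upwards [h.isOpen.mem_nhds hq] with r hr using h.spray_eq r hr w
  have h4 := congrArg (fun T : V × V →L[ℝ] ℝ => T (0, u))
    ((h1.congr_of_eventuallyEq h3.symm).unique h2)
  simp at h4
  linarith

/-- Horizontal vectors `u - N u` annihilate `A = L²`, that is, `δL/δx = 0`. -/
theorem fderiv_horizontal {q : V × V} (hq : q ∈ Ω) (u : V) :
    A₁ q (u, -fderiv ℝ G q (0, u)) = 0 := by
  have h1 := h.spray_eq₁ hq u q.2
  have e1 := h.euler₁ hq (0, fderiv ℝ G q (0, u))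
  have e2 := h.euler₁ hq (u, 0)
  have e3 := h.euler₂ hq (0, G q) (0, u)
  have e4 := h.euler₂ hq (q.2, 0) (0, u)
  have s1 := h.symm₃' hq (0, u) (0, G q) (0, q.2)
  have s2 := h.symm₂ hq (0, fderiv ℝ G q (0, u)) (0, q.2)
  have s3 := h.symm₂ hq (0, u) (0, G q)
  have s4 := h.symm₂ hq (0, u) (q.2, 0)
  have z : A₁ q ((0 : V), (0 : V)) = 0 := map_zero _
  have z' : A₂ q (0, u) ((0 : V), (0 : V)) = 0 := map_zero _
  have d : A₁ q (u, -fderiv ℝ G q (0, u)) = A₁ q (u, 0) - A₁ q (0, fderiv ℝ G q (0, u)) := by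
    rw [← map_sub]; simp
  simp only at e1 e2 e3 e4
  linarith

/-- Euler's identity `N y = 2 G`: the spray is homogeneous of degree two. -/
theorem euler_spray {q : V × V} (hq : q ∈ Ω) : fderiv ℝ G q (0, q.2) = (2 : ℝ) • G q := by
  rw [← sub_eq_zero]
  refine h.nondegenerate q hq _ fun w => ?_
  have h1 := h.spray_eq₁ hq q.2 w
  have h2 := h.spray_eq q hq w
  have d : A₂ q (0, w) (0, fderiv ℝ G q (0, q.2) - (2 : ℝ) • G q) =
      A₂ q (0, w) (0, fderiv ℝ G q (0, q.2)) - 2 * A₂ q (0, w) (0, G q) := by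
    rw [← smul_eq_mul (2 : ℝ), ← map_smul, ← map_sub]; simp
  have e1 := h.euler₂ hq (0, w) (q.2, 0)
  have e2 := h.euler₂ hq (0, w) (0, G q)
  have e3 := h.euler₁ hq (w, 0)
  have s1 := h.symm₃ hq (0, q.2) (q.2, 0) (0, w)
  have s2 := h.symm₃' hq (q.2, 0) (0, q.2) (0, w)
  have s3 := h.symm₃' hq (0, q.2) (0, w) (0, G q)
  have s4 := h.symm₃ hq (0, q.2) (0, G q) (0, w)
  have s5 := h.symm₃' hq (0, G q) (0, q.2) (0, w)
  have s6 := h.symm₂ hq (0, q.2) (w, 0)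
  have s7 := h.symm₂ hq (0, w) (0, G q)
  have z : A₁ q ((0 : V), (0 : V)) = 0 := map_zero _
  have z' : A₂ q (0, w) ((0 : V), (0 : V)) = 0 := map_zero _
  simp only at e1 e2 e3
  linarith

/-- The derivative of the Hilbert form `L L_y` in a horizontal direction is symmetric: its exterior
derivative vanishes on pairs of horizontal vectors. -/
theorem horizontal_symm {q : V × V} (hq : q ∈ Ω) (u w : V) :
    A₂ q (u, -fderiv ℝ G q (0, u)) (0, w) = A₂ q (w, -fderiv ℝ G q (0, w)) (0, u) := by
  have d : ∀ u w : V, A₂ q (u, -fderiv ℝ G q (0, u)) (0, w) =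
      A₂ q (u, 0) (0, w) - A₂ q (0, w) (0, fderiv ℝ G q (0, u)) := fun u w => by
    rw [h.symm₂ hq (0, w), ← sub_apply, ← map_sub]; simp
  rw [d, d]
  have h1 := h.spray_eq₁ hq u w
  have h2 := h.spray_eq₁ hq w u
  have s1 := h.symm₃ hq (0, u) (q.2, 0) (0, w)
  have s2 := h.symm₃ hq (0, w) (q.2, 0) (0, u)
  have s3 := h.symm₃' hq (q.2, 0) (0, u) (0, w)
  have s4 := h.symm₃ hq (0, u) (0, w) (0, G q)
  have s5 := h.symm₂ hq (0, u) (w, 0)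
  have s6 := h.symm₂ hq (0, w) (u, 0)
  linarith

/-- The fundamental tensor is parallel along the geodesic spray: `(y - N y) g = g(N ·, ·) + g(·, N ·)`. -/
theorem fundamental_parallel {q : V × V} (hq : q ∈ Ω) (u w : V) :
    A₃ q (q.2, -fderiv ℝ G q (0, q.2)) (0, u) (0, w) =
      A₂ q (0, w) (0, fderiv ℝ G q (0, u)) + A₂ q (0, u) (0, fderiv ℝ G q (0, w)) := by
  have d : A₃ q (q.2, -fderiv ℝ G q (0, q.2)) (0, u) (0, w) =
      A₃ q (q.2, 0) (0, u) (0, w) - 2 * A₃ q (0, G q) (0, u) (0, w) := by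
    rw [h.euler_spray hq]
    have : (q.2, -((2 : ℝ) • G q)) = (q.2, (0 : V)) - (2 : ℝ) • ((0 : V), G q) := by simp
    rw [this, map_sub, map_smul]
    simp
  rw [d]
  have h1 := h.spray_eq₁ hq u w
  have h2 := h.spray_eq₁ hq w u
  have s1 := h.symm₃ hq (0, u) (q.2, 0) (0, w)
  have s2 := h.symm₃ hq (0, w) (q.2, 0) (0, u)
  have s3 := h.symm₃' hq (q.2, 0) (0, u) (0, w)
  have s4 := h.symm₃' hq (0, u) (0, w) (0, G q)
  have s5 := h.symm₃ hq (0, u) (0, G q) (0, w)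
  have s6 := h.symm₃' hq (0, w) (0, u) (0, G q)
  have s7 := h.symm₃ hq (0, w) (0, G q) (0, u)
  have s8 := h.symm₃' hq (0, G q) (0, u) (0, w)
  have s9 := h.symm₂ hq (0, u) (w, 0)
  have s10 := h.symm₂ hq (0, w) (u, 0)
  linarith

end
end IsSpray
end Spray

/-! ### Brackets of an adapted moving frame -/

section LieDerivative

variable {E : Type*} [NormedAddCommGroup E] [NormedSpace ℝ E]
  {G : Type*} [NormedAddCommGroup G] [NormedSpace ℝ G]
  {G' : Type*} [NormedAddCommGroup G'] [NormedSpace ℝ G']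
  {S : Type*} [TopologicalSpace S] [ChartedSpace E S]

theorem lieD_comp {Φ : G → G'} {f : S → G} {p : S} (hΦ : DifferentiableAt ℝ Φ (f p))
    (hf : MDifferentiableAt 𝓘(ℝ, E) 𝓘(ℝ, G) f p) (X : VField E S) :
    lieD (fun q => Φ (f q)) X p = fderiv ℝ Φ (f p) (lieD f X p) := by
  have := (hΦ.hasFDerivAt.hasMFDerivAt.comp p hf.hasMFDerivAt).mfderiv
  exact congrArg (fun T => T (X p)) this

theorem lieD_prodMk {f : S → G} {g : S → G'} {p : S}
    (hf : MDifferentiableAt 𝓘(ℝ, E) 𝓘(ℝ, G) f p) (hg : MDifferentiableAt 𝓘(ℝ, E) 𝓘(ℝ, G') g p)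
    (X : VField E S) : lieD (fun q => (f q, g q)) X p = (lieD f X p, lieD g X p) := by
  have h := hf.prodMk_space hg
  refine Prod.ext ?_ ?_
  · have := lieD_comp (Φ := (Prod.fst : G × G' → G)) differentiableAt_fst h X
    rw [fderiv_fst] at this
    exact this.symm
  · have := lieD_comp (Φ := (Prod.snd : G × G' → G')) differentiableAt_snd h X
    rw [fderiv_snd] at this
    exact this.symm

theorem mdifferentiableAt_comp_of_differentiableAt {Φ : G → G'} {f : S → G} {p : S}
    (hΦ : DifferentiableAt ℝ Φ (f p)) (hf : MDifferentiableAt 𝓘(ℝ, E) 𝓘(ℝ, G) f p) :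
    MDifferentiableAt 𝓘(ℝ, E) 𝓘(ℝ, G') (fun q => Φ (f q)) p :=
  hΦ.mdifferentiableAt.comp p hf

theorem mdifferentiableAt_clm_apply {T : S → G →L[ℝ] G'} {v : S → G} {p : S}
    (hT : MDifferentiableAt 𝓘(ℝ, E) 𝓘(ℝ, G →L[ℝ] G') T p)
    (hv : MDifferentiableAt 𝓘(ℝ, E) 𝓘(ℝ, G) v p) :
    MDifferentiableAt 𝓘(ℝ, E) 𝓘(ℝ, G') (fun q => T q (v q)) p :=
  mdifferentiableAt_comp_of_differentiableAt (Φ := fun r : (G →L[ℝ] G') × G => r.1 r.2)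
    (f := fun q => (T q, v q))
    (isBoundedBilinearMap_apply.differentiableAt (T p, v p)) (hT.prodMk_space hv)

theorem lieD_clm_apply {T : S → G →L[ℝ] G'} {v : S → G} {p : S}
    (hT : MDifferentiableAt 𝓘(ℝ, E) 𝓘(ℝ, G →L[ℝ] G') T p)
    (hv : MDifferentiableAt 𝓘(ℝ, E) 𝓘(ℝ, G) v p) (X : VField E S) :
    lieD (fun q => T q (v q)) X p = lieD T X p (v p) + T p (lieD v X p) := by
  have h := lieD_comp (Φ := fun r : (G →L[ℝ] G') × G => r.1 r.2)
    (f := fun q => (T q, v q))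
    (isBoundedBilinearMap_apply.differentiableAt (T p, v p)) (hT.prodMk_space hv) X
  rw [lieD_prodMk hT hv, isBoundedBilinearMap_apply.fderiv] at h
  rw [h, add_comm]
  rfl

theorem mdifferentiableAt_inr {v : S → G} {p : S} (hv : MDifferentiableAt 𝓘(ℝ, E) 𝓘(ℝ, G) v p) :
    MDifferentiableAt 𝓘(ℝ, E) 𝓘(ℝ, G' × G) (fun q => ((0 : G'), v q)) p :=
  mdifferentiableAt_const.prodMk_space hv

theorem lieD_congr {f g : S → G} {p : S} (hfg : f =ᶠ[𝓝 p] g) (X : VField E S) :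
    lieD f X p = lieD g X p := by
  unfold lieD
  rw [hfg.mfderiv_eq]
  rfl

theorem lieD_const (a : G) (X : VField E S) (p : S) : lieD (fun _ => a) X p = 0 := by
  unfold lieD
  rw [mfderiv_const]
  rfl

theorem lieD_inr {v : S → G} {p : S} (hv : MDifferentiableAt 𝓘(ℝ, E) 𝓘(ℝ, G) v p)
    (X : VField E S) : lieD (fun q => ((0 : G'), v q)) X p = (0, lieD v X p) := by
  rw [lieD_prodMk mdifferentiableAt_const hv, lieD_const]

theorem lieD_of_eqOn_const {f : S → G} {a : G} {W : Set S} (hW : IsOpen W)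
    (hf : ∀ q ∈ W, f q = a) (X : VField E S) {p : S} (hp : p ∈ W) : lieD f X p = 0 := by
  rw [lieD_congr (g := fun _ => a) (eventuallyEq_of_mem (hW.mem_nhds hp) hf), lieD_const]

end LieDerivative

section MovingFrame

variable {E : Type*} [NormedAddCommGroup E] [NormedSpace ℝ E]
  {S : Type*} [TopologicalSpace S] [ChartedSpace E S] [IsManifold 𝓘(ℝ, E) ∞ S]
  {V : Type*} [NormedAddCommGroup V] [NormedSpace ℝ V] {m : ℕ}

theorem SmoothFieldOn.mdifferentiableAt {W : Set S} {X : VField E S} (hX : SmoothFieldOn W X)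
    (hW : IsOpen W) {p : S} (hp : p ∈ W) : MDifferentiableAt 𝓘(ℝ, E) 𝓘(ℝ, E).tangent
      (fun q => (⟨q, X q⟩ : TangentBundle 𝓘(ℝ, E) S)) p :=
  (hX.contMDiffAt (hW.mem_nhds hp)).mdifferentiableAt (by simp)

/-- The data of an adapted moving frame, in coordinates: `x` are the base coordinates on `S` and
`u i` are the components of the orthonormal frame `e_i`, whose last member is the unit vector `y = l`,
so that `(x, u (Fin.last m)) : S → V × V` is the section `l`. The differential of this section maps the
field `X (Sum.inl i)` to the horizontal lift `u_i - N u_i` of `e_i`, and `X (Sum.inr α)` to the vertical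
vector `-u_α` (the sign is that of `J (δ/δyⁱ) = -δ/δxⁱ`, with `L = 1`). Orthonormality is stated for
the vertical Hessian of `A = L²`, which is `2 g`. -/
structure IsMovingFrame (A : V × V → ℝ) (Ω : Set (V × V)) (G : V × V → V) (W : Set S)
    (x : S → V) (u : Fin (m + 1) → S → V) (X : Fin (m + 1) ⊕ Fin m → VField E S) : Prop where
  isOpen : IsOpen W
  spray : IsSpray A Ω G
  smooth_base : ContMDiffOn 𝓘(ℝ, E) 𝓘(ℝ, V) ∞ x W
  smooth_frame : ∀ i, ContMDiffOn 𝓘(ℝ, E) 𝓘(ℝ, V) ∞ (u i) W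
  smooth_field : ∀ a, SmoothFieldOn W (X a)
  mem : ∀ p ∈ W, (x p, u (Fin.last m) p) ∈ Ω
  orthonormal : ∀ p ∈ W, ∀ i j,
    fderiv ℝ (fderiv ℝ A) (x p, u (Fin.last m) p) (0, u i p) (0, u j p) = if i = j then 2 else 0
  base_horizontal : ∀ p ∈ W, ∀ i, lieD x (X (Sum.inl i)) p = u i p
  fibre_horizontal : ∀ p ∈ W, ∀ i, lieD (u (Fin.last m)) (X (Sum.inl i)) p =
    -fderiv ℝ G (x p, u (Fin.last m) p) (0, u i p)
  base_vertical : ∀ p ∈ W, ∀ α, lieD x (X (Sum.inr α)) p = 0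
  fibre_vertical : ∀ p ∈ W, ∀ α, lieD (u (Fin.last m)) (X (Sum.inr α)) p = -u α.castSucc p

namespace IsMovingFrame

variable {A : V × V → ℝ} {Ω : Set (V × V)} {G : V × V → V} {W : Set S}
    {x : S → V} {u : Fin (m + 1) → S → V} {X : Fin (m + 1) ⊕ Fin m → VField E S}

variable (h : IsMovingFrame A Ω G W x u X)
include h

theorem mdiff_base {p : S} (hp : p ∈ W) : MDifferentiableAt 𝓘(ℝ, E) 𝓘(ℝ, V) x p :=
  (h.smooth_base.contMDiffAt (h.isOpen.mem_nhds hp)).mdifferentiableAt (by simp)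

theorem mdiff_frame {p : S} (hp : p ∈ W) (i : Fin (m + 1)) :
    MDifferentiableAt 𝓘(ℝ, E) 𝓘(ℝ, V) (u i) p :=
  ((h.smooth_frame i).contMDiffAt (h.isOpen.mem_nhds hp)).mdifferentiableAt (by simp)

theorem mdiff_point {p : S} (hp : p ∈ W) :
    MDifferentiableAt 𝓘(ℝ, E) 𝓘(ℝ, V × V) (fun q => (x q, u (Fin.last m) q)) p :=
  (h.mdiff_base hp).prodMk_space (h.mdiff_frame hp _)

theorem lieD_bracket [CompleteSpace E] {Y Z : VField E S} (hY : SmoothFieldOn W Y)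
    (hZ : SmoothFieldOn W Z) {p : S} (hp : p ∈ W) :
    lieD x (VectorField.mlieBracket 𝓘(ℝ, E) Y Z) p = lieD (lieD x Z) Y p - lieD (lieD x Y) Z p :=
  lieD_mlieBracket ((h.smooth_base.contMDiffAt (h.isOpen.mem_nhds hp)).of_le ENat.LEInfty.out)
    (hY.mdifferentiableAt h.isOpen hp) (hZ.mdifferentiableAt h.isOpen hp)

theorem lieD_lieD_horizontal (i : Fin (m + 1)) (Y : VField E S) {p : S} (hp : p ∈ W) :
    lieD (lieD x (X (Sum.inl i))) Y p = lieD (u i) Y p :=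
  lieD_congr (eventuallyEq_of_mem (h.isOpen.mem_nhds hp) fun q hq => h.base_horizontal q hq i) Y

/-- The base components of `[Y, X_i]` for vertical `Y` are the derivatives of `u_i` along `Y`. In
particular they do not involve derivatives of `Y`. -/
theorem lieD_bracket_of_vertical [CompleteSpace E] {Y : VField E S} (hY : SmoothFieldOn W Y)
    (hv : ∀ q ∈ W, lieD x Y q = 0) (i : Fin (m + 1)) {p : S} (hp : p ∈ W) :
    lieD x (VectorField.mlieBracket 𝓘(ℝ, E) Y (X (Sum.inl i))) p = lieD (u i) Y p := by
  rw [h.lieD_bracket hY (h.smooth_field _) hp, h.lieD_lieD_horizontal i Y hp,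
    lieD_of_eqOn_const h.isOpen hv _ hp, sub_zero]

theorem lieD_bracket_horizontal [CompleteSpace E] (i j : Fin (m + 1)) {p : S} (hp : p ∈ W) :
    lieD x (VectorField.mlieBracket 𝓘(ℝ, E) (X (Sum.inl i)) (X (Sum.inl j))) p =
      lieD (u j) (X (Sum.inl i)) p - lieD (u i) (X (Sum.inl j)) p := by
  rw [h.lieD_bracket (h.smooth_field _) (h.smooth_field _) hp, h.lieD_lieD_horizontal i _ hp,
    h.lieD_lieD_horizontal j _ hp]

/-- Differentiation of the relation `ωⁿ(u_i) = const`, where `ωⁿ = g(l, dx)` is the Hilbert form. -/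
theorem hilbert_lieD_frame (i : Fin (m + 1)) (Y : VField E S) {p : S} (hp : p ∈ W) :
    fderiv ℝ (fderiv ℝ A) (x p, u (Fin.last m) p) (0, u (Fin.last m) p) (0, lieD (u i) Y p) =
      -fderiv ℝ (fderiv ℝ A) (x p, u (Fin.last m) p)
        (lieD x Y p, lieD (u (Fin.last m)) Y p) (0, u i p) := by
  -- by Euler's identity, `2 g(y, ·)` is the vertical differential of `A`
  have e : ∀ q ∈ W, ∀ v : V, fderiv ℝ (fderiv ℝ A) (x q, u (Fin.last m) q)
      (0, u (Fin.last m) q) (0, v) = fderiv ℝ A (x q, u (Fin.last m) q) (0, v) := fun q hq v => by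
    rw [h.spray.symm₂ (h.mem q hq), h.spray.euler₁ (h.mem q hq)]
    ring
  rw [e p hp]
  have h1 : lieD (fun q => fderiv ℝ A (x q, u (Fin.last m) q) (0, u i q)) Y p = 0 := by
    refine lieD_of_eqOn_const h.isOpen (a := if Fin.last m = i then 2 else 0) (fun q hq => ?_) Y hp
    rw [← e q hq, h.orthonormal q hq]
  have d : MDifferentiableAt 𝓘(ℝ, E) 𝓘(ℝ, V × V →L[ℝ] ℝ)
      (fun q => fderiv ℝ A (x q, u (Fin.last m) q)) p :=
    mdifferentiableAt_comp_of_differentiableAt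
      (h.spray.hasFDerivAt₁ (h.mem p hp)).differentiableAt (h.mdiff_point hp)
  rw [lieD_clm_apply d (mdifferentiableAt_inr (h.mdiff_frame hp i)),
    lieD_comp (Φ := fderiv ℝ A) (f := fun q => (x q, u (Fin.last m) q))
      (h.spray.hasFDerivAt₁ (h.mem p hp)).differentiableAt
      (h.mdiff_point hp), lieD_prodMk (h.mdiff_base hp) (h.mdiff_frame hp _),
    lieD_inr (h.mdiff_frame hp i)] at h1
  linarith

/-- Differentiation of the relations `g(u_i, u_j) = const`. -/
theorem orthonormal_lieD (i j : Fin (m + 1)) (Y : VField E S) {p : S} (hp : p ∈ W) :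
    fderiv ℝ (fderiv ℝ (fderiv ℝ A)) (x p, u (Fin.last m) p)
        (lieD x Y p, lieD (u (Fin.last m)) Y p) (0, u i p) (0, u j p) +
      fderiv ℝ (fderiv ℝ A) (x p, u (Fin.last m) p) (0, u j p) (0, lieD (u i) Y p) +
      fderiv ℝ (fderiv ℝ A) (x p, u (Fin.last m) p) (0, u i p) (0, lieD (u j) Y p) = 0 := by
  have h1 : lieD (fun q => fderiv ℝ (fderiv ℝ A) (x q, u (Fin.last m) q) (0, u i q) (0, u j q))
      Y p = 0 :=
    lieD_of_eqOn_const h.isOpen (fun q hq => h.orthonormal q hq i j) Y hp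
  have d : MDifferentiableAt 𝓘(ℝ, E) 𝓘(ℝ, V × V →L[ℝ] V × V →L[ℝ] ℝ)
      (fun q => fderiv ℝ (fderiv ℝ A) (x q, u (Fin.last m) q)) p :=
    mdifferentiableAt_comp_of_differentiableAt
      (h.spray.hasFDerivAt₂ (h.mem p hp)).differentiableAt (h.mdiff_point hp)
  have di := mdifferentiableAt_inr (G' := V) (h.mdiff_frame hp i)
  have dj := mdifferentiableAt_inr (G' := V) (h.mdiff_frame hp j)
  rw [lieD_clm_apply (mdifferentiableAt_clm_apply d di) dj, lieD_clm_apply d di,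
    lieD_comp (Φ := fderiv ℝ (fderiv ℝ A)) (f := fun q => (x q, u (Fin.last m) q))
      (h.spray.hasFDerivAt₂ (h.mem p hp)).differentiableAt
      (h.mdiff_point hp), lieD_prodMk (h.mdiff_base hp) (h.mdiff_frame hp _),
    lieD_inr (h.mdiff_frame hp i), lieD_inr (h.mdiff_frame hp j), add_apply] at h1
  rw [h.spray.symm₂ (h.mem p hp) (0, u j p) (0, lieD (u i) Y p)]
  exact h1

/-- `ωⁿ([X_{n+β}, X_i]) = δ_{βi}` (both sides doubled). -/
theorem hilbert_bracket_vertical [CompleteSpace E] (β : Fin m) (i : Fin (m + 1)) {p : S}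
    (hp : p ∈ W) :
    fderiv ℝ (fderiv ℝ A) (x p, u (Fin.last m) p) (0, u (Fin.last m) p)
      (0, lieD x (VectorField.mlieBracket 𝓘(ℝ, E) (X (Sum.inr β)) (X (Sum.inl i))) p) =
        if β.castSucc = i then 2 else 0 := by
  rw [h.lieD_bracket_of_vertical (h.smooth_field _) (fun q hq => h.base_vertical q hq β) i hp,
    h.hilbert_lieD_frame i _ hp, h.base_vertical p hp, h.fibre_vertical p hp,
    ← h.orthonormal p hp β.castSucc i, ← neg_apply, ← map_neg]
  simp

/-- `ωⁿ([X_i, X_j]) = 0`: the horizontal brackets have no component along `l`. -/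
theorem hilbert_bracket_horizontal [CompleteSpace E] (i j : Fin (m + 1)) {p : S} (hp : p ∈ W) :
    fderiv ℝ (fderiv ℝ A) (x p, u (Fin.last m) p) (0, u (Fin.last m) p)
      (0, lieD x (VectorField.mlieBracket 𝓘(ℝ, E) (X (Sum.inl i)) (X (Sum.inl j))) p) = 0 := by
  have d : ∀ v w : V, ((0 : V), v - w) = (0, v) - (0, w) := by simp
  rw [h.lieD_bracket_horizontal i j hp, d, map_sub, h.hilbert_lieD_frame i _ hp,
    h.hilbert_lieD_frame j _ hp, h.base_horizontal p hp, h.fibre_horizontal p hp,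
    h.base_horizontal p hp, h.fibre_horizontal p hp, h.spray.horizontal_symm (h.mem p hp)]
  ring

/-- `ωʲ([X_n, X_i]) + ωⁱ([X_n, X_j]) = 0`: the flow of the Reeb field `X_n` preserves the horizontal
metric to first order on horizontal vectors. -/
theorem bracket_reeb_antisymm [CompleteSpace E] (i j : Fin (m + 1)) {p : S} (hp : p ∈ W) :
    fderiv ℝ (fderiv ℝ A) (x p, u (Fin.last m) p) (0, u j p) (0, lieD x
        (VectorField.mlieBracket 𝓘(ℝ, E) (X (Sum.inl (Fin.last m))) (X (Sum.inl i))) p) +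
      fderiv ℝ (fderiv ℝ A) (x p, u (Fin.last m) p) (0, u i p) (0, lieD x
        (VectorField.mlieBracket 𝓘(ℝ, E) (X (Sum.inl (Fin.last m))) (X (Sum.inl j))) p) = 0 := by
  have d : ∀ v w : V, ((0 : V), v - -w) = (0, v) + (0, w) := by simp
  rw [h.lieD_bracket_horizontal _ _ hp, h.lieD_bracket_horizontal _ _ hp,
    h.fibre_horizontal p hp, h.fibre_horizontal p hp, d, d, map_add, map_add]
  have h1 := h.orthonormal_lieD i j (X (Sum.inl (Fin.last m))) hp
  rw [h.fibre_horizontal p hp, h.base_horizontal p hp] at h1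
  have h2 := h.spray.fundamental_parallel (h.mem p hp) (u i p) (u j p)
  simp only at h2
  linarith

/-- The bracket `[X_{n+β}, X_n]` projects to `-e_β`, since `u_n = y`. -/
theorem bracket_vertical_reeb [CompleteSpace E] (β : Fin m) {p : S} (hp : p ∈ W) :
    lieD x (VectorField.mlieBracket 𝓘(ℝ, E) (X (Sum.inr β)) (X (Sum.inl (Fin.last m)))) p =
      -u β.castSucc p := by
  rw [h.lieD_bracket_of_vertical (h.smooth_field _) (fun q hq => h.base_vertical q hq β) _ hp,
    h.fibre_vertical p hp]

end IsMovingFrame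
end MovingFrame

/-! ### Spray coefficients in coordinates -/

section Coordinates

variable {n : ℕ}

theorem differentiableAt_det {E : Type*} [NormedAddCommGroup E] [NormedSpace ℝ E]
    {B : E → Matrix (Fin n) (Fin n) ℝ} {q : E}
    (hB : ∀ i j, DifferentiableAt ℝ (fun r => B r i j) q) :
    DifferentiableAt ℝ (fun r => (B r).det) q := by
  simp only [Matrix.det_apply]
  fun_prop

theorem differentiableAt_inv_entry {E : Type*} [NormedAddCommGroup E] [NormedSpace ℝ E]
    {B : E → Matrix (Fin n) (Fin n) ℝ} {q : E}
    (hB : ∀ i j, DifferentiableAt ℝ (fun r => B r i j) q) (hq : (B q).det ≠ 0) (i j : Fin n) :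
    DifferentiableAt ℝ (fun r => (B r)⁻¹ i j) q := by
  simp only [Matrix.inv_def, Ring.inverse_eq_inv', Matrix.smul_apply, smul_eq_mul,
    Matrix.adjugate_apply]
  refine ((differentiableAt_det hB).inv hq).mul (differentiableAt_det fun k l => ?_)
  by_cases hk : k = j
  · subst hk
    simp
  · simpa [Matrix.updateRow_ne hk] using hB k l

theorem vec_eq_sum (v : Vec n) : v = ∑ i, v i • EuclideanSpace.single i (1 : ℝ) := by
  ext j
  simp [Pi.single_apply]

theorem inr_eq_sum (v : Vec n) :
    ((0 : Vec n), v) = ∑ i, v i • ((0 : Vec n), EuclideanSpace.single i (1 : ℝ)) := by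
  conv_lhs => rw [vec_eq_sum v]
  exact (map_sum (ContinuousLinearMap.inr ℝ (Vec n) (Vec n))
    (fun i => v i • EuclideanSpace.single i (1 : ℝ)) Finset.univ).trans (by simp)

theorem inl_eq_sum (v : Vec n) :
    (v, (0 : Vec n)) = ∑ i, v i • (EuclideanSpace.single i (1 : ℝ), (0 : Vec n)) := by
  conv_lhs => rw [vec_eq_sum v]
  exact (map_sum (ContinuousLinearMap.inl ℝ (Vec n) (Vec n))
    (fun i => v i • EuclideanSpace.single i (1 : ℝ)) Finset.univ).trans (by simp)

variable {L : Vec n × Vec n → ℝ} {q : Vec n × Vec n}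

theorem fderiv_apply_const {A : Vec n × Vec n → ℝ} (hA : DifferentiableAt ℝ (fderiv ℝ A) q)
    (a b : Vec n × Vec n) : fderiv ℝ (fun r => fderiv ℝ A r b) q a =
      fderiv ℝ (fderiv ℝ A) q a b := by
  rw [(hA.hasFDerivAt.clm_apply (hasFDerivAt_const b q)).fderiv]
  simp

theorem fundMatrix_apply (hL : DifferentiableAt ℝ (fderiv ℝ fun r => L r ^ 2) q) (i j : Fin n) :
    fundMatrix L q i j = 1 / 2 * fderiv ℝ (fderiv ℝ fun r => L r ^ 2) q
      (0, EuclideanSpace.single j 1) (0, EuclideanSpace.single i 1) :=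
  congrArg (1 / 2 * ·) (fderiv_apply_const hL _ _)

/-- The vertical Hessian of `L²` is twice the fundamental tensor. -/
theorem hessian_eq_fundMatrix (hL : DifferentiableAt ℝ (fderiv ℝ fun r => L r ^ 2) q)
    (v w : Vec n) : fderiv ℝ (fderiv ℝ fun r => L r ^ 2) q (0, w) (0, v) =
      2 * ∑ i, ∑ j, fundMatrix L q i j * v i * w j := by
  rw [inr_eq_sum v, inr_eq_sum w]
  simp only [map_sum, map_smul, sum_apply, smul_apply, smul_eq_mul, Finset.mul_sum,
    fundMatrix_apply hL]
  refine Finset.sum_congr rfl fun i _ => Finset.sum_congr rfl fun j _ => ?_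
  ring

variable (L) in
/-- The vector `(G¹, …, Gⁿ)` of spray coefficients. -/
noncomputable def sprayVec (q : Vec n × Vec n) : Vec n := WithLp.toLp 2 fun i => sprayCoeff L i q

/-- The spray coefficients of a coordinate Finsler structure `L` on `U × (ℝⁿ ∖ 0)` satisfy the
abstract description of a spray. -/
theorem isSpray_sprayVec {U : Set (Vec n)} (hU : IsOpen U)
    (hL : ContDiffOn ℝ ∞ L (U ×ˢ {0}ᶜ))
    (hom : ∀ a ∈ U, ∀ y : Vec n, y ≠ 0 → ∀ r : ℝ, 0 < r → L (a, r • y) = r * L (a, y))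
    (hpos : ∀ a ∈ U, ∀ y : Vec n, y ≠ 0 → (fundMatrix L (a, y)).PosDef) :
    IsSpray (fun r => L r ^ 2) (U ×ˢ {0}ᶜ) (sprayVec L) := by
  have hΩ : IsOpen (U ×ˢ ({0}ᶜ : Set (Vec n))) := hU.prod isOpen_compl_singleton
  have h0 : ContDiffOn ℝ ∞ (fun r => L r ^ 2) (U ×ˢ {0}ᶜ) := hL.pow 2
  have h1 : ContDiffOn ℝ ∞ (fderiv ℝ fun r => L r ^ 2) (U ×ˢ {0}ᶜ) :=
    h0.fderiv_of_isOpen hΩ (by simp)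
  have h2 : ContDiffOn ℝ ∞ (fderiv ℝ (fderiv ℝ fun r => L r ^ 2)) (U ×ˢ {0}ᶜ) :=
    h1.fderiv_of_isOpen hΩ (by simp)
  have d0 : ∀ q ∈ U ×ˢ ({0}ᶜ : Set (Vec n)), DifferentiableAt ℝ (fun r => L r ^ 2) q :=
    fun q hq => (h0.contDiffAt (hΩ.mem_nhds hq)).differentiableAt (by simp)
  have d1 : ∀ q ∈ U ×ˢ ({0}ᶜ : Set (Vec n)), DifferentiableAt ℝ (fderiv ℝ fun r => L r ^ 2) q :=
    fun q hq => (h1.contDiffAt (hΩ.mem_nhds hq)).differentiableAt (by simp)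
  have d2 : ∀ q ∈ U ×ˢ ({0}ᶜ : Set (Vec n)),
      DifferentiableAt ℝ (fderiv ℝ (fderiv ℝ fun r => L r ^ 2)) q :=
    fun q hq => (h2.contDiffAt (hΩ.mem_nhds hq)).differentiableAt (by simp)
  have hdet : ∀ q ∈ U ×ˢ ({0}ᶜ : Set (Vec n)), (fundMatrix L q).det ≠ 0 :=
    fun q hq => (hpos q.1 hq.1 q.2 hq.2).det_pos.ne'
  have hsymm : ∀ q ∈ U ×ˢ ({0}ᶜ : Set (Vec n)), ∀ i j, fundMatrix L q i j = fundMatrix L q j i :=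
    fun q hq i j => by simpa using (hpos q.1 hq.1 q.2 hq.2).isHermitian.apply j i
  refine ⟨hΩ, h0, ?_, ?_, ?_, ?_⟩
  · intro q hq
    have hX : ∀ j, DifferentiableAt ℝ (fun r => pdX j (fun r => L r ^ 2) r) q := fun j =>
      (d1 q hq).clm_apply (differentiableAt_const _)
    have hg : ∀ i j, DifferentiableAt ℝ (fun r => fundMatrix L r i j) q := fun i j => by
      have : DifferentiableAt ℝ (fun r => 1 / 2 * fderiv ℝ (fderiv ℝ fun r => L r ^ 2) r
          (0, EuclideanSpace.single j 1) (0, EuclideanSpace.single i 1)) q :=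
        (((d2 q hq).clm_apply (differentiableAt_const _)).clm_apply
          (differentiableAt_const _)).const_mul _
      refine this.congr_of_eventuallyEq ?_
      filter_upwards [hΩ.mem_nhds hq] with r hr using fundMatrix_apply (d1 r hr) i j
    have hXY : ∀ j k, DifferentiableAt ℝ (fun r => pdX k (pdY j fun r => L r ^ 2) r) q :=
        fun j k => by
      have : DifferentiableAt ℝ (fun r => fderiv ℝ (fderiv ℝ fun r => L r ^ 2) r
          (EuclideanSpace.single k 1, 0) (0, EuclideanSpace.single j 1)) q :=
        ((d2 q hq).clm_apply (differentiableAt_const _)).clm_apply (differentiableAt_const _)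
      refine this.congr_of_eventuallyEq ?_
      filter_upwards [hΩ.mem_nhds hq] with r hr using fderiv_apply_const (d1 r hr) _ _
    have hy : ∀ k, DifferentiableAt ℝ (fun r : Vec n × Vec n => r.2 k) q := fun k => by fun_prop
    rw [differentiableAt_euclidean]
    intro i
    exact (DifferentiableAt.fun_sum fun j _ => (differentiableAt_inv_entry hg (hdet q hq) i j).mul
      ((DifferentiableAt.fun_sum fun k _ => (hXY j k).mul (hy k)).sub (hX j))).const_mul _
  · rintro ⟨a, y⟩ hq
    have e1 : HasDerivAt (fun r : ℝ => (a, r • y)) (0, y) 1 := by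
      have := (hasDerivAt_const (1 : ℝ) a).prodMk ((hasDerivAt_id (1 : ℝ)).smul_const y)
      simpa using this
    have e2 : HasDerivAt (fun r : ℝ => L (a, r • y) ^ 2)
        (fderiv ℝ (fun r => L r ^ 2) (a, y) (0, y)) 1 := by
      have h3 : HasFDerivAt (fun r => L r ^ 2) (fderiv ℝ (fun r => L r ^ 2) (a, y))
        ((fun r : ℝ => (a, r • y)) 1) := by simpa using (d0 _ hq).hasFDerivAt
      exact h3.comp_hasDerivAt 1 e1
    have e3 : HasDerivAt (fun r : ℝ => (r * L (a, y)) ^ 2) (2 * L (a, y) ^ 2) 1 := by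
      have := ((hasDerivAt_id (1 : ℝ)).mul_const (L (a, y))).pow 2
      simp at this
      convert! this using 1
      ring
    refine e2.unique (e3.congr_of_eventuallyEq ?_)
    filter_upwards [lt_mem_nhds (zero_lt_one' ℝ)] with r hr
    rw [hom a hq.1 y hq.2 r hr]
  · intro q hq v hv
    by_contra hne
    have h3 := (hpos q.1 hq.1 q.2 hq.2).dotProduct_mulVec_pos (x := v.ofLp) (by simpa using hne)
    have h4 := hv v
    rw [hessian_eq_fundMatrix (d1 q hq)] at h4
    have h5 : ∑ i, ∑ j, fundMatrix L q i j * v i * v j = 0 := by linarith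
    refine h3.ne' (Eq.trans ?_ h5)
    simp only [dotProduct, Matrix.mulVec, Finset.mul_sum, Pi.star_apply, star_trivial]
    refine Finset.sum_congr rfl fun i _ => Finset.sum_congr rfl fun j _ => ?_
    ring
  · intro q hq w
    set R : Fin n → ℝ := fun j =>
      ∑ k, pdX k (pdY j fun r => L r ^ 2) q * q.2 k - pdX j (fun r => L r ^ 2) q with hR
    have e1 : (fun i => sprayVec L q i) = (1 / 4 : ℝ) • ((fundMatrix L q)⁻¹).mulVec R := rfl
    have e2 : (fundMatrix L q).mulVec (fun i => sprayVec L q i) = (1 / 4 : ℝ) • R := by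
      rw [e1, Matrix.mulVec_smul, Matrix.mulVec_mulVec, Matrix.mul_nonsing_inv _
        (hdet q hq).isUnit, Matrix.one_mulVec]
    have e3 : ∑ i, ∑ j, fundMatrix L q i j * sprayVec L q i * w j =
        ∑ j, w j * (fundMatrix L q).mulVec (fun i => sprayVec L q i) j := by
      rw [Finset.sum_comm]
      refine Finset.sum_congr rfl fun j _ => ?_
      rw [Matrix.mulVec, dotProduct, Finset.mul_sum]
      refine Finset.sum_congr rfl fun i _ => ?_
      rw [hsymm q hq i j]
      ring
    have e4 : fderiv ℝ (fderiv ℝ fun r => L r ^ 2) q (q.2, 0) (0, w) -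
        fderiv ℝ (fun r => L r ^ 2) q (w, 0) = ∑ j, w j * R j := by
      rw [inl_eq_sum q.2, inr_eq_sum w, inl_eq_sum w]
      simp only [map_sum, map_smul, sum_apply, smul_apply, smul_eq_mul, hR, mul_sub,
        Finset.sum_sub_distrib, Finset.mul_sum]
      congr 1
      refine Finset.sum_congr rfl fun j _ => Finset.sum_congr rfl fun k _ => ?_
      unfold pdX pdY
      rw [fderiv_apply_const (d1 q hq)]
      ring
    rw [hessian_eq_fundMatrix (d1 q hq), e3, e2, e4, Finset.mul_sum, Finset.mul_sum]
    refine Finset.sum_congr rfl fun j _ => ?_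
    simp only [Pi.smul_apply, smul_eq_mul]
    ring

end Coordinates

/-! ### Coordinate expressions on the tangent bundle -/

section Charts

variable {m : ℕ} {M : Type*} [TopologicalSpace M] [ChartedSpace (Vec (m + 1)) M]
  [IsManifold (𝓡 (m + 1)) ∞ M] {c : OpenPartialHomeomorph M (Vec (m + 1))}

theorem contMDiff_tangentBundle_mk : ContMDiff 𝓘(ℝ, Vec (m + 1) × Vec (m + 1))
    (𝓡 (m + 1)).tangent ∞ (fun q : Vec (m + 1) × Vec (m + 1) =>
      (⟨q.1, q.2⟩ : TangentBundle (𝓡 (m + 1)) (Vec (m + 1)))) := by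
  have h := contMDiff_tangentBundleModelSpaceHomeomorph_symm (I := 𝓡 (m + 1)) (n := ∞)
  rw [modelWithCornersSelf_prod]
  exact h

theorem contMDiffOn_chartDSymm (hc : c ∈ IsManifold.maximalAtlas (𝓡 (m + 1)) ∞ M) :
    ContMDiffOn 𝓘(ℝ, Vec (m + 1) × Vec (m + 1)) (𝓡 (m + 1)).tangent ∞
      (fun q : Vec (m + 1) × Vec (m + 1) =>
        (⟨c.symm q.1, chartDSymm c q.1 q.2⟩ : TangentBundle (𝓡 (m + 1)) M))
      (c.target ×ˢ univ) := by
  have h := (contMDiffOn_symm_of_mem_maximalAtlas hc).contMDiffOn_tangentMapWithin (m := ∞)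
    (by simp) c.open_target.uniqueMDiffOn
  refine (h.comp contMDiff_tangentBundle_mk.contMDiffOn (s := c.target ×ˢ univ)
    fun q hq => hq.1).congr ?_
  rintro ⟨a, y⟩ hq
  simp only [Function.comp_apply, tangentMapWithin]
  rw [mfderivWithin_of_isOpen c.open_target hq.1]
  rfl

theorem contDiffOn_coordF {F : TangentBundle (𝓡 (m + 1)) M → ℝ} (hF : IsFinsler F)
    (hc : c ∈ IsManifold.maximalAtlas (𝓡 (m + 1)) ∞ M) :
    ContDiffOn ℝ ∞ (coordF F c) (c.target ×ˢ {0}ᶜ) := by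
  rw [← contMDiffOn_iff_contDiffOn]
  refine hF.smooth.comp ((contMDiffOn_chartDSymm hc).mono (prod_mono_right (subset_univ _))) ?_
  rintro ⟨a, y⟩ ⟨ha, hy⟩ h0
  have h1 := chartD_chartDSymm hc ha y
  have h2 : chartDSymm c a y = 0 := h0
  rw [h2, map_zero] at h1
  exact hy h1.symm

theorem isSpray_coordF {F : TangentBundle (𝓡 (m + 1)) M → ℝ} (hF : IsFinsler F)
    (hc : c ∈ IsManifold.maximalAtlas (𝓡 (m + 1)) ∞ M) :
    IsSpray (fun r => coordF F c r ^ 2) (c.target ×ˢ {0}ᶜ) (sprayVec (coordF F c)) := by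
  refine isSpray_sprayVec c.open_target (contDiffOn_coordF hF hc) ?_ (hF.posDef c hc)
  intro a ha y hy r hr
  have h0 : chartDSymm c a y ≠ 0 := fun h => by
    have h1 := chartD_chartDSymm hc ha y
    rw [h, map_zero] at h1
    exact hy h1.symm
  unfold coordF
  simp only [map_smul]
  exact hF.homogeneous _ _ r h0 hr

variable {E : Type*} [NormedAddCommGroup E] [NormedSpace ℝ E]
  {S : Type*} [TopologicalSpace S] [ChartedSpace E S]

theorem contMDiffOn_chartD (hc : c ∈ IsManifold.maximalAtlas (𝓡 (m + 1)) ∞ M) {W : Set S}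
    {f : S → M} {v : ∀ p, TangentSpace (𝓡 (m + 1)) (f p)}
    (hv : ContMDiffOn 𝓘(ℝ, E) (𝓡 (m + 1)).tangent ∞
      (fun p => (⟨f p, v p⟩ : TangentBundle (𝓡 (m + 1)) M)) W) (hf : ∀ p ∈ W, f p ∈ c.source) :
    ContMDiffOn 𝓘(ℝ, E) 𝓘(ℝ, Vec (m + 1)) ∞ (fun p => chartD c (f p) (v p)) W := by
  have h := (contMDiffOn_of_mem_maximalAtlas hc).contMDiffOn_tangentMapWithin (m := ∞)
    (by simp) c.open_source.uniqueMDiffOn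
  refine ((contMDiff_snd_tangentBundle_modelSpace (Vec (m + 1)) (𝓡 (m + 1))).comp_contMDiffOn
    (h.comp hv (s := W) fun p hp => hf p hp)).congr ?_
  intro p hp
  have h1 : mfderivWithin (𝓡 (m + 1)) (𝓡 (m + 1)) c c.source (f p) = chartD c (f p) :=
    mfderivWithin_of_isOpen c.open_source (hf p hp)
  exact congrArg (fun T => T (v p)) h1.symm

/-- In the coordinates `(x, y)` of a tangent vector, `coordF` has the value of `F`. The base points
`c.symm (c x)` and `x` are only propositionally equal, so the equality is transported by hand. -/
theorem coordF_chartD {F : TangentBundle (𝓡 (m + 1)) M → ℝ}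
    (hc : c ∈ IsManifold.maximalAtlas (𝓡 (m + 1)) ∞ M) {x : M} (hx : x ∈ c.source)
    (w : TangentSpace (𝓡 (m + 1)) x) : coordF F c (c x, chartD c x w) = F ⟨x, w⟩ := by
  have h1 := chartDSymm_chartD hc hx w
  have h2 : ∀ (x' : M) (hx' : x' = x) (w' : TangentSpace (𝓡 (m + 1)) x'),
      (w' : Vec (m + 1)) = w → F ⟨x', w'⟩ = F ⟨x, w⟩ := by
    rintro x' rfl w' rfl
    rfl
  exact h2 _ (c.left_inv hx) _ h1

theorem tautSection_ne_zero {F : TangentBundle (𝓡 (m + 1)) M → ℝ} (hF : IsFinsler F)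
    (p : SphereBundle m M) : tautSection F p ≠ 0 :=
  smul_ne_zero (inv_ne_zero (hF.pos ⟨p.pt, p.rep⟩ p.rep_ne_zero).ne') p.rep_ne_zero

theorem apply_tautSection {F : TangentBundle (𝓡 (m + 1)) M → ℝ} (hF : IsFinsler F)
    (p : SphereBundle m M) : F ⟨p.pt, tautSection F p⟩ = 1 := by
  have h := hF.pos ⟨p.pt, p.rep⟩ p.rep_ne_zero
  unfold tautSection
  rw [hF.homogeneous _ _ _ p.rep_ne_zero (inv_pos.2 h), inv_mul_cancel₀ h.ne']

theorem tautCoord_mem {F : TangentBundle (𝓡 (m + 1)) M → ℝ} (hF : IsFinsler F)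
    (hc : c ∈ IsManifold.maximalAtlas (𝓡 (m + 1)) ∞ M) {p : SphereBundle m M}
    (hp : p.pt ∈ c.source) : tautCoord F c p ∈ c.target ×ˢ ({0}ᶜ : Set (Vec (m + 1))) := by
  refine ⟨c.map_source hp, fun h0 => tautSection_ne_zero hF p ?_⟩
  have h1 := chartDSymm_chartD hc hp (tautSection F p)
  have h2 : chartD c p.pt (tautSection F p) = 0 := h0
  rw [h2, map_zero] at h1
  exact h1.symm

end Charts

/-! ### Vector fields and the Levi-Civita connection on an open set -/

section Fields

variable {E : Type*} [NormedAddCommGroup E] [NormedSpace ℝ E]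
  {S : Type*} [TopologicalSpace S] [ChartedSpace E S] [IsManifold 𝓘(ℝ, E) ∞ S]
  {W : Set S}

theorem contMDiffOn_lieD {G : Type*} [NormedAddCommGroup G] [NormedSpace ℝ G] {f : S → G}
    (hW : IsOpen W) (hf : ContMDiffOn 𝓘(ℝ, E) 𝓘(ℝ, G) ∞ f W) {X : VField E S}
    (hX : SmoothFieldOn W X) : ContMDiffOn 𝓘(ℝ, E) 𝓘(ℝ, G) ∞ (lieD f X) W := by
  have h := hf.contMDiffOn_tangentMapWithin (m := ∞) (by simp) hW.uniqueMDiffOn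
  refine ((contMDiff_snd_tangentBundle_modelSpace G 𝓘(ℝ, G)).comp_contMDiffOn
    (h.comp hX fun p hp => hp)).congr ?_
  intro p hp
  have h1 : mfderivWithin 𝓘(ℝ, E) 𝓘(ℝ, G) f W p = mfderiv 𝓘(ℝ, E) 𝓘(ℝ, G) f p :=
    mfderivWithin_of_isOpen hW hp
  exact congrArg (fun T => T (X p)) h1.symm

theorem SmoothFieldOn.congr {X Y : VField E S} (hX : SmoothFieldOn W X)
    (h : ∀ p ∈ W, Y p = X p) : SmoothFieldOn W Y :=
  ContMDiffOn.congr hX fun p hp => by rw [h p hp]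

theorem SmoothFieldOn.sub {X Y : VField E S} (hX : SmoothFieldOn W X) (hY : SmoothFieldOn W Y) :
    SmoothFieldOn W (fun q => X q - Y q) :=
  ContMDiffOn.sub_section hX hY

theorem SmoothFieldOn.smul {f : S → ℝ} {X : VField E S} (hf : ContMDiffOn 𝓘(ℝ, E) 𝓘(ℝ, ℝ) ∞ f W)
    (hX : SmoothFieldOn W X) : SmoothFieldOn W (fun q => f q • X q) :=
  ContMDiffOn.smul_section hf hX

theorem SmoothFieldOn.sum_smul {ι : Type*} (s : Finset ι) {f : ι → S → ℝ} {X : ι → VField E S}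
    (hf : ∀ i, ContMDiffOn 𝓘(ℝ, E) 𝓘(ℝ, ℝ) ∞ (f i) W) (hX : ∀ i, SmoothFieldOn W (X i)) :
    SmoothFieldOn W (fun q => ∑ i ∈ s, f i q • X i q) :=
  ContMDiffOn.sum_section fun i _ => SmoothFieldOn.smul (hf i) (hX i)

variable {g : (p : S) → LinearMap.BilinForm ℝ (TangentSpace 𝓘(ℝ, E) p)}
  {D : VField E S → VField E S → VField E S}

namespace IsLeviCivitaOn

variable (hD : IsLeviCivitaOn W g D)
include hD

/-- The operator `D` is local in its first argument. -/
theorem congr_left {X X' Y : VField E S} (hX : SmoothFieldOn W X) (hX' : SmoothFieldOn W X')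
    (hY : SmoothFieldOn W Y) (h : ∀ p ∈ W, X p = X' p) {p : S} (hp : p ∈ W) :
    D X Y p = D X' Y p := by
  classical
  -- multiplying by the indicator function of `W` makes the two fields equal everywhere
  let f : S → ℝ := W.indicator 1
  have hf : ContMDiffOn 𝓘(ℝ, E) 𝓘(ℝ, ℝ) ∞ f W :=
    contMDiffOn_const (c := (1 : ℝ)) |>.congr fun q hq => by simp [f, hq]
  have h1 : (fun q => f q • X q) = fun q => f q • X' q := by
    funext q
    by_cases hq : q ∈ W
    · rw [h q hq]
    · simp [f, hq]
  have h2 := hD.smul_left f X Y hf hX hY p hp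
  have h3 := hD.smul_left f X' Y hf hX' hY p hp
  rw [h1, h3] at h2
  simpa [f, hp] using h2.symm

theorem sum_smul_left {ι : Type*} (s : Finset ι) {f : ι → S → ℝ} {X : ι → VField E S}
    {Y : VField E S} (hf : ∀ i, ContMDiffOn 𝓘(ℝ, E) 𝓘(ℝ, ℝ) ∞ (f i) W)
    (hX : ∀ i, SmoothFieldOn W (X i)) (hY : SmoothFieldOn W Y) {p : S} (hp : p ∈ W) :
    D (fun q => ∑ i ∈ s, f i q • X i q) Y p = ∑ i ∈ s, f i p • D (X i) Y p := by
  classical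
  induction s using Finset.induction_on with
  | empty =>
    have h := hD.smul_left (fun _ => 0) Y Y contMDiffOn_const hY hY p hp
    simpa using h
  | insert i s hi ih =>
    simp only [Finset.sum_insert hi]
    rw [hD.add_left _ _ _ (SmoothFieldOn.smul (hf i) (hX i)) (SmoothFieldOn.sum_smul s hf hX) hY
      p hp, hD.smul_left _ _ _ (hf i) (hX i) hY p hp, ih]

/-- The antisymmetry of the Levi-Civita coefficients of an orthonormal frame, and the Koszul formula
for them. -/
theorem koszul {ι : Type*} [DecidableEq ι] (hW : IsOpen W) {X : ι → VField E S}
    (hX : ∀ a, SmoothFieldOn W (X a))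
    (hg : ∀ p ∈ W, ∀ a b, g p (X a p) (X b p) = if a = b then 1 else 0)
    (hs : ∀ p ∈ W, ∀ v w, g p v w = g p w v) {p : S} (hp : p ∈ W) (a b c : ι) :
    g p (D (X a) (X b) p) (X c p) = -g p (D (X a) (X c) p) (X b p) ∧
    2 * g p (D (X a) (X b) p) (X c p) =
      g p (VectorField.mlieBracket 𝓘(ℝ, E) (X a) (X b) p) (X c p) -
      g p (VectorField.mlieBracket 𝓘(ℝ, E) (X b) (X c) p) (X a p) +
      g p (VectorField.mlieBracket 𝓘(ℝ, E) (X c) (X a) p) (X b p) := by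
  have anti : ∀ a b c, g p (D (X a) (X b) p) (X c p) = -g p (D (X a) (X c) p) (X b p) := by
    intro a b c
    have h1 := hD.metric (X a) (X b) (X c) (hX a) (hX b) (hX c) p hp
    have h2 : dirDeriv (X a) (fun q => g q (X b q) (X c q)) p = 0 :=
      lieD_of_eqOn_const hW (fun q hq => hg q hq b c) (X a) hp
    rw [h2, hs p hp (X b p)] at h1
    linarith
  refine ⟨anti a b c, ?_⟩
  have tor : ∀ a b c, g p (VectorField.mlieBracket 𝓘(ℝ, E) (X a) (X b) p) (X c p) =
      g p (D (X a) (X b) p) (X c p) - g p (D (X b) (X a) p) (X c p) := by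
    intro a b c
    rw [← hD.torsion_free _ _ (hX a) (hX b) p hp, map_sub, LinearMap.sub_apply]
  rw [tor, tor, tor]
  have h1 := anti a b c
  have h2 := anti b a c
  have h3 := anti c a b
  linarith

end IsLeviCivitaOn
end Fields

/-! ### The components of an adapted frame -/

section AdaptedFrame

variable {m : ℕ} {M : Type*} [TopologicalSpace M] [ChartedSpace (Vec (m + 1)) M]
  {F : TangentBundle (𝓡 (m + 1)) M → ℝ} {c : OpenPartialHomeomorph M (Vec (m + 1))}
  {e : PullbackFrame m M}

/-- The base coordinates `(x¹, …, xⁿ)` as functions on `SM`. -/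
noncomputable def baseCoord (c : OpenPartialHomeomorph M (Vec (m + 1))) (p : SphereBundle m M) : Vec (m + 1) :=
  c p.pt

/-- The components `(u¹_i, …, uⁿ_i)` of the frame vector `e_i`. -/
noncomputable def frameCoord (c : OpenPartialHomeomorph M (Vec (m + 1))) (e : PullbackFrame m M)
    (i : Fin (m + 1)) (p : SphereBundle m M) : Vec (m + 1) :=
  chartD c p.pt (e i p)

/-- The form `w ↦ g(e_i, w) = ½ [F²]_{yʲyᵏ} uʲ_i wᵏ`, with `g` evaluated at the section `l = e_n`. On
adapted frames it is the dual form `ωⁱ`. -/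
noncomputable def frameForm (F : TangentBundle (𝓡 (m + 1)) M → ℝ) (c : OpenPartialHomeomorph M (Vec (m + 1)))
    (e : PullbackFrame m M) (i : Fin (m + 1)) (p : SphereBundle m M) (w : Vec (m + 1)) : ℝ :=
  1 / 2 * fderiv ℝ (fderiv ℝ fun r => coordF F c r ^ 2)
    (baseCoord c p, frameCoord c e (Fin.last m) p) (0, frameCoord c e i p) (0, w)

theorem frameForm_add (i : Fin (m + 1)) (p : SphereBundle m M) (v w : Vec (m + 1)) :
    frameForm F c e i p (v + w) = frameForm F c e i p v + frameForm F c e i p w := by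
  have : ((0 : Vec (m + 1)), v + w) = (0, v) + (0, w) := by simp
  unfold frameForm
  rw [this, map_add]
  ring

theorem frameForm_smul (i : Fin (m + 1)) (p : SphereBundle m M) (r : ℝ) (w : Vec (m + 1)) :
    frameForm F c e i p (r • w) = r * frameForm F c e i p w := by
  have : ((0 : Vec (m + 1)), r • w) = r • (0, w) := by simp
  unfold frameForm
  rw [this, map_smul, smul_eq_mul]
  ring

theorem frameForm_neg (i : Fin (m + 1)) (p : SphereBundle m M) (w : Vec (m + 1)) :
    frameForm F c e i p (-w) = -frameForm F c e i p w := by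
  simpa using frameForm_smul (F := F) (c := c) (e := e) i p (-1) w

theorem frameForm_sub (i : Fin (m + 1)) (p : SphereBundle m M) (v w : Vec (m + 1)) :
    frameForm F c e i p (v - w) = frameForm F c e i p v - frameForm F c e i p w := by
  rw [sub_eq_add_neg, frameForm_add, frameForm_neg, ← sub_eq_add_neg]

section

variable [IsManifold (𝓡 (m + 1)) ∞ M] {W : Set (SphereBundle m M)} (he : IsAdaptedFrame F c W e)
include he

theorem contMDiffOn_pt : ContMDiffOn 𝓘(ℝ, Vec (m + 1) × Vec m) (𝓡 (m + 1)) ∞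
    (SphereBundle.pt : SphereBundle m M → M) W :=
  (Bundle.contMDiff_proj (TangentSpace (𝓡 (m + 1)) : M → Type _)).comp_contMDiffOn (he.smooth 0)

theorem tautCoord_eq {p : SphereBundle m M} (hp : p ∈ W) :
    tautCoord F c p = (baseCoord c p, frameCoord c e (Fin.last m) p) := by
  unfold tautCoord baseCoord frameCoord
  rw [he.last_eq p hp]

variable (hc : c ∈ IsManifold.maximalAtlas (𝓡 (m + 1)) ∞ M) (hWc : ∀ p ∈ W, p.pt ∈ c.source)
include hc hWc

theorem contMDiffOn_baseCoord : ContMDiffOn 𝓘(ℝ, Vec (m + 1) × Vec m) 𝓘(ℝ, Vec (m + 1)) ∞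
    (baseCoord c) W :=
  (contMDiffOn_of_mem_maximalAtlas hc).comp (contMDiffOn_pt he) hWc

theorem contMDiffOn_frameCoord (i : Fin (m + 1)) :
    ContMDiffOn 𝓘(ℝ, Vec (m + 1) × Vec m) 𝓘(ℝ, Vec (m + 1)) ∞ (frameCoord c e i) W :=
  contMDiffOn_chartD hc (he.smooth i) hWc

variable (hF : IsFinsler F)
include hF

theorem point_mem {p : SphereBundle m M} (hp : p ∈ W) :
    (baseCoord c p, frameCoord c e (Fin.last m) p) ∈
      c.target ×ˢ ({0}ᶜ : Set (Vec (m + 1))) := by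
  rw [← tautCoord_eq he hp]
  exact tautCoord_mem hF hc (hWc p hp)

theorem coordF_point {p : SphereBundle m M} (hp : p ∈ W) :
    coordF F c (baseCoord c p, frameCoord c e (Fin.last m) p) = 1 := by
  rw [← tautCoord_eq he hp, ← apply_tautSection hF p]
  exact coordF_chartD hc (hWc p hp) _

theorem frameForm_eq_sum {p : SphereBundle m M} (hp : p ∈ W) (i : Fin (m + 1))
    (w : Vec (m + 1)) : frameForm F c e i p w =
      ∑ k, ∑ l, fundMatrix (coordF F c) (tautCoord F c p) k l * frameCoord c e i p k * w l := by
  have hs := isSpray_coordF hF hc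
  have hq := point_mem he hc hWc hF hp
  unfold frameForm
  rw [hs.symm₂ hq, hessian_eq_fundMatrix (hs.hasFDerivAt₁ hq).differentiableAt,
    tautCoord_eq he hp]
  ring

theorem frameForm_frameCoord {p : SphereBundle m M} (hp : p ∈ W) (i j : Fin (m + 1)) :
    frameForm F c e i p (frameCoord c e j p) = if i = j then 1 else 0 := by
  rw [frameForm_eq_sum he hc hWc hF hp]
  exact he.orthonormal p hp i j

/-- Orthonormality `Uᵀ g U = 1` of the matrix `U` of components shows that `U⁻¹ = Uᵀ g`; in particular
the inverse in `coframeMatrix` is a true one. -/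
theorem coframeMatrix_eq {p : SphereBundle m M} (hp : p ∈ W) :
    coframeMatrix c e p * Matrix.of (fun j i => frameCoord c e i p j) = 1 ∧
    ∀ i (w : Vec (m + 1)), ∑ j, coframeMatrix c e p i j * w j = frameForm F c e i p w := by
  set U : Matrix (Fin (m + 1)) (Fin (m + 1)) ℝ := Matrix.of fun j i => frameCoord c e i p j with hU
  set g := fundMatrix (coordF F c) (tautCoord F c p) with hg
  have h1 : (U.transpose * g) * U = 1 := by
    ext i j
    rw [Matrix.one_apply, ← frameForm_frameCoord he hc hWc hF hp,
      frameForm_eq_sum he hc hWc hF hp, Finset.sum_comm]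
    simp only [Matrix.mul_apply, Finset.sum_mul, Matrix.transpose_apply, hU, Matrix.of_apply]
    refine Finset.sum_congr rfl fun k _ => Finset.sum_congr rfl fun l _ => ?_
    ring
  have h2 : coframeMatrix c e p = U.transpose * g := Matrix.inv_eq_left_inv h1
  refine ⟨h2 ▸ h1, fun i w => ?_⟩
  rw [h2, frameForm_eq_sum he hc hWc hF hp, Finset.sum_comm]
  simp only [Matrix.mul_apply, Finset.sum_mul, Matrix.transpose_apply, hU, Matrix.of_apply]
  refine Finset.sum_congr rfl fun k _ => Finset.sum_congr rfl fun l _ => ?_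
  ring

theorem eq_zero_of_frameForm {p : SphereBundle m M} (hp : p ∈ W) {w : Vec (m + 1)}
    (hw : ∀ i, frameForm F c e i p w = 0) : w = 0 := by
  obtain ⟨h1, h2⟩ := coframeMatrix_eq he hc hWc hF hp
  have h3 : (coframeMatrix c e p).mulVec w.ofLp = 0 := by
    ext i
    exact (h2 i w).trans (hw i)
  have h4 := congrArg (Matrix.mulVec (Matrix.of fun j i => frameCoord c e i p j)) h3
  rw [Matrix.mulVec_mulVec, mul_eq_one_comm.1 h1, Matrix.one_mulVec, Matrix.mulVec_zero]
    at h4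
  ext i
  exact congrFun h4 i

theorem omegaLift_apply {p : SphereBundle m M} (hp : p ∈ W) (i : Fin (m + 1))
    (w : Vec (m + 1) × Vec (m + 1)) : omegaLift c e i p w = frameForm F c e i p w.1 := by
  rw [← (coframeMatrix_eq he hc hWc hF hp).2]
  simp [omegaLift, coDeltaX]

/-- The base components of `J w` are `-(dy + N dx)(w)`, since `F = 1` along `l`. -/
theorem almostJ_apply_fst {p : SphereBundle m M} (hp : p ∈ W) (w : Vec (m + 1) × Vec (m + 1)) :
    (almostJ (coordF F c) (tautCoord F c p) w).1 = -(w.2 + fderiv ℝ (sprayVec (coordF F c))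
      (baseCoord c p, frameCoord c e (Fin.last m) p) (0, w.1)) := by
  have hs := isSpray_coordF hF hc
  have hq := point_mem he hc hWc hF hp
  rw [tautCoord_eq he hp]
  set q := (baseCoord c p, frameCoord c e (Fin.last m) p) with hqd
  have hd := hs.spray_differentiable q hq
  have h1 : ∀ j, HasFDerivAt (sprayCoeff (coordF F c) j)
      ((EuclideanSpace.proj j : Vec (m + 1) →L[ℝ] ℝ) ∘L fderiv ℝ (sprayVec (coordF F c)) q) q :=
    fun j => (EuclideanSpace.proj j : Vec (m + 1) →L[ℝ] ℝ).hasFDerivAt.comp q hd.hasFDerivAt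
  have h2 : ∀ j, fderiv ℝ (sprayVec (coordF F c)) q (0, w.1) j =
      ∑ k, pdY k (sprayCoeff (coordF F c) j) q * w.1 k := by
    intro j
    have h3 : fderiv ℝ (sprayVec (coordF F c)) q (0, w.1) j =
        fderiv ℝ (sprayCoeff (coordF F c) j) q (0, w.1) := by
      rw [(h1 j).fderiv]
      rfl
    rw [h3, inr_eq_sum w.1]
    simp only [map_sum, map_smul, smul_eq_mul, pdY]
    exact Finset.sum_congr rfl fun k _ => mul_comm _ _
  ext j
  simp only [almostJ, deltaX, deltaY, coDeltaY, coDeltaX, sum_apply,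
    sub_apply, ContinuousLinearMap.smulRight_apply, Prod.fst_sum, Prod.fst_sub, Prod.smul_fst]
  simp [hqd, coordF_point he hc hWc hF hp, Pi.single_apply]
  exact (h2 j).symm

end
end AdaptedFrame

/-! ### The dual frame and the orthogonal projection -/

section DualFrame

variable {m : ℕ} {M : Type*} [TopologicalSpace M] [ChartedSpace (Vec (m + 1)) M]
  [IsManifold (𝓡 (m + 1)) ∞ M]
  {F : TangentBundle (𝓡 (m + 1)) M → ℝ} {c : OpenPartialHomeomorph M (Vec (m + 1))}
  {W : Set (SphereBundle m M)} {e : PullbackFrame m M}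

section
variable (hW : IsOpen W) (he : IsAdaptedFrame F c W e)
  (hc : c ∈ IsManifold.maximalAtlas (𝓡 (m + 1)) ∞ M) (hWc : ∀ p ∈ W, p.pt ∈ c.source)
include hW he hc hWc

theorem tautD_apply {p : SphereBundle m M} (hp : p ∈ W)
    (X : VField (Vec (m + 1) × Vec m) (SphereBundle m M)) :
    tautD F c p (X p) = (lieD (baseCoord c) X p, lieD (frameCoord c e (Fin.last m)) X p) := by
  rw [← lieD_prodMk
    (((contMDiffOn_baseCoord he hc hWc).contMDiffAt (hW.mem_nhds hp)).mdifferentiableAt (by simp))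
    (((contMDiffOn_frameCoord he hc hWc _).contMDiffAt (hW.mem_nhds hp)).mdifferentiableAt
      (by simp))]
  exact lieD_congr (f := tautCoord F c)
    (eventuallyEq_of_mem (hW.mem_nhds hp) fun q hq => tautCoord_eq he hq) X

theorem mem_vertical_iff {p : SphereBundle m M} (hp : p ∈ W)
    (X : VField (Vec (m + 1) × Vec m) (SphereBundle m M)) :
    X p ∈ vertical p ↔ lieD (baseCoord c) X p = 0 := by
  have h1 : MDifferentiableAt 𝓘(ℝ, Vec (m + 1) × Vec m) (𝓡 (m + 1))
      (SphereBundle.pt : SphereBundle m M → M) p :=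
    ((contMDiffOn_pt he).contMDiffAt (hW.mem_nhds hp)).mdifferentiableAt (by simp)
  have h2 := mfderiv_comp (I'' := 𝓡 (m + 1)) p
    ((chart_mdifferentiable hc).mdifferentiableAt (hWc p hp)) h1
  have h3 : lieD (baseCoord c) X p = chartD c p.pt (mfderiv 𝓘(ℝ, Vec (m + 1) × Vec m)
      (𝓡 (m + 1)) (SphereBundle.pt : SphereBundle m M → M) p (X p)) :=
    congrArg (fun T => T (X p)) h2
  rw [h3]
  constructor
  · intro h
    have h4 : mfderiv 𝓘(ℝ, Vec (m + 1) × Vec m)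
      (𝓡 (m + 1)) (SphereBundle.pt : SphereBundle m M → M) p (X p) = 0 := h
    rw [h4, map_zero]
  · intro h
    have h4 := chartDSymm_chartD hc (hWc p hp) (mfderiv 𝓘(ℝ, Vec (m + 1) × Vec m)
      (𝓡 (m + 1)) (SphereBundle.pt : SphereBundle m M → M) p (X p))
    rw [h, map_zero] at h4
    exact h4.symm

variable (hF : IsFinsler F)
include hF

theorem coframe_inl_apply {p : SphereBundle m M} (hp : p ∈ W) (i : Fin (m + 1))
    (X : VField (Vec (m + 1) × Vec m) (SphereBundle m M)) :
    coframe F c e (Sum.inl i) p (X p) = frameForm F c e i p (lieD (baseCoord c) X p) := by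
  have h := omegaLift_apply he hc hWc hF hp i (tautD F c p (X p))
  rw [tautD_apply hW he hc hWc hp X] at h
  rw [← h, ← tautD_apply hW he hc hWc hp X]
  rfl

theorem coframe_inr_apply {p : SphereBundle m M} (hp : p ∈ W) (α : Fin m)
    (X : VField (Vec (m + 1) × Vec m) (SphereBundle m M)) :
    coframe F c e (Sum.inr α) p (X p) = -frameForm F c e α.castSucc p
      (lieD (frameCoord c e (Fin.last m)) X p + fderiv ℝ (sprayVec (coordF F c))
        (baseCoord c p, frameCoord c e (Fin.last m) p) (0, lieD (baseCoord c) X p)) := by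
  have h := omegaLift_apply he hc hWc hF hp α.castSucc
    (almostJ (coordF F c) (tautCoord F c p) (tautD F c p (X p)))
  rw [almostJ_apply_fst he hc hWc hF hp, frameForm_neg, tautD_apply hW he hc hWc hp X] at h
  rw [← h, ← tautD_apply hW he hc hWc hp X]
  rfl

/-- The form `F_{yⁱ} δyⁱ` vanishes on `SM`, because `F = 1` along the section `l`. -/
theorem frameForm_last_vertical {p : SphereBundle m M} (hp : p ∈ W)
    (X : VField (Vec (m + 1) × Vec m) (SphereBundle m M)) :
    frameForm F c e (Fin.last m) p
      (lieD (frameCoord c e (Fin.last m)) X p + fderiv ℝ (sprayVec (coordF F c))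
        (baseCoord c p, frameCoord c e (Fin.last m) p) (0, lieD (baseCoord c) X p)) = 0 := by
  have hs := isSpray_coordF hF hc
  have hq := point_mem he hc hWc hF hp
  have d1 := ((contMDiffOn_baseCoord he hc hWc).contMDiffAt (hW.mem_nhds hp)).mdifferentiableAt
    (by simp)
  have d2 := ((contMDiffOn_frameCoord he hc hWc (Fin.last m)).contMDiffAt
    (hW.mem_nhds hp)).mdifferentiableAt (by simp)
  have h1 : lieD (fun q => coordF F c (baseCoord c q, frameCoord c e (Fin.last m) q) ^ 2) X p = 0 :=
    lieD_of_eqOn_const hW (a := 1) (fun q hq => by rw [coordF_point he hc hWc hF hq, one_pow]) X hp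
  rw [lieD_comp (Φ := fun r => coordF F c r ^ 2)
    (f := fun q => (baseCoord c q, frameCoord c e (Fin.last m) q))
    (hs.hasFDerivAt₀ hq).differentiableAt (d1.prodMk_space d2), lieD_prodMk d1 d2] at h1
  have h2 := hs.fderiv_horizontal hq (lieD (baseCoord c) X p)
  unfold frameForm
  rw [hs.symm₂ hq, hs.euler₁ hq]
  set b := lieD (baseCoord c) X p
  set w := lieD (frameCoord c e (Fin.last m)) X p
  set v := fderiv ℝ (sprayVec (coordF F c))
        (baseCoord c p, frameCoord c e (Fin.last m) p) (0, b)
  have h3 : ((0 : Vec (m + 1)), w + v) = (b, w) - (b, -v) := by simp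
  rw [h3, map_sub, h1, h2]
  simp

variable {E : Fin (m + 1) ⊕ Fin m → VField (Vec (m + 1) × Vec m) (SphereBundle m M)}
  (hE : IsDualFrame W (coframe F c e) E)
include hE

/-- The dual frame of the coframe `ω¹, …, ω²ⁿ⁻¹` consists of the horizontal lifts of the `e_i` and the
vertical vectors `-e_α`. -/
theorem isMovingFrame : IsMovingFrame (fun r => coordF F c r ^ 2)
    (c.target ×ˢ ({0}ᶜ : Set (Vec (m + 1)))) (sprayVec (coordF F c)) W (baseCoord c)
    (frameCoord c e) E := by
  have base_h : ∀ p ∈ W, ∀ i, lieD (baseCoord c) (E (Sum.inl i)) p = frameCoord c e i p := by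
    intro p hp i
    refine sub_eq_zero.1 (eq_zero_of_frameForm he hc hWc hF hp fun j => ?_)
    rw [frameForm_sub, ← coframe_inl_apply hW he hc hWc hF hp, hE.dual p hp,
      frameForm_frameCoord he hc hWc hF hp]
    simp
  have base_v : ∀ p ∈ W, ∀ α, lieD (baseCoord c) (E (Sum.inr α)) p = 0 := by
    intro p hp α
    refine eq_zero_of_frameForm he hc hWc hF hp fun j => ?_
    rw [← coframe_inl_apply hW he hc hWc hF hp, hE.dual p hp]
    simp
  refine ⟨hW, isSpray_coordF hF hc, contMDiffOn_baseCoord he hc hWc,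
    contMDiffOn_frameCoord he hc hWc, hE.smooth, fun p hp => point_mem he hc hWc hF hp, ?_,
    base_h, ?_, base_v, ?_⟩
  · intro p hp i j
    have h := frameForm_frameCoord he hc hWc hF hp i j
    unfold frameForm at h
    split_ifs at h ⊢ <;> linarith
  · intro p hp i
    have h := frameForm_last_vertical hW he hc hWc hF hp (E (Sum.inl i))
    have h' : ∀ α, _ := fun α => coframe_inr_apply hW he hc hWc hF hp α (E (Sum.inl i))
    rw [base_h p hp] at h
    simp only [base_h p hp] at h'
    refine eq_neg_of_add_eq_zero_left (eq_zero_of_frameForm he hc hWc hF hp fun j => ?_)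
    induction j using Fin.lastCases with
    | last => exact h
    | cast α =>
      have h2 := h' α
      rw [hE.dual p hp] at h2
      simpa using h2.symm
  · intro p hp β
    have h := frameForm_last_vertical hW he hc hWc hF hp (E (Sum.inr β))
    have h' : ∀ α, _ := fun α => coframe_inr_apply hW he hc hWc hF hp α (E (Sum.inr β))
    have z : ((0 : Vec (m + 1)), (0 : Vec (m + 1))) = 0 := rfl
    rw [base_v p hp, z, map_zero, add_zero] at h
    simp only [base_v p hp, z, map_zero, add_zero] at h'
    refine eq_neg_of_add_eq_zero_left (eq_zero_of_frameForm he hc hWc hF hp fun j => ?_)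
    rw [frameForm_add, frameForm_frameCoord he hc hWc hF hp]
    induction j using Fin.lastCases with
    | last =>
      rw [h, if_neg (Fin.castSucc_lt_last β).ne', add_zero]
    | cast α =>
      have h2 := h' α
      rw [hE.dual p hp] at h2
      simp only [Sum.inr.injEq] at h2
      simp only [Fin.castSucc_inj]
      linarith

omit hW he hc hWc hF in
/-- A dual system of `2n - 1` vectors and covectors on a space of that dimension is a pair of bases. -/
theorem eq_sum_coframe {p : SphereBundle m M} (hp : p ∈ W)
    (v : TangentSpace 𝓘(ℝ, Vec (m + 1) × Vec m) p) :
    v = ∑ a, coframe F c e a p v • E a p := by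
  classical
  have hli : LinearIndependent ℝ (fun a => (E a p : TangentSpace 𝓘(ℝ, Vec (m + 1) × Vec m) p)) := by
    rw [Fintype.linearIndependent_iff]
    intro f hf b
    have h := congrArg (coframe F c e b p) hf
    simpa [-Fintype.sum_sum_type, map_sum, hE.dual p hp] using h
  have : FiniteDimensional ℝ (TangentSpace 𝓘(ℝ, Vec (m + 1) × Vec m) p) :=
    inferInstanceAs (FiniteDimensional ℝ (Vec (m + 1) × Vec m))
  have hfr : Module.finrank ℝ (TangentSpace 𝓘(ℝ, Vec (m + 1) × Vec m) p) = m + 1 + m :=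
    (show Module.finrank ℝ (Vec (m + 1) × Vec m) = m + 1 + m by simp)
  have hsp := hli.span_eq_top_of_card_eq_finrank' (by rw [hfr]; simp)
  have hv : v ∈ Submodule.span ℝ (Set.range fun a => E a p) := hsp ▸ Submodule.mem_top
  obtain ⟨f, rfl⟩ := (Submodule.mem_span_range_iff_exists_fun ℝ).1 hv
  refine Finset.sum_congr rfl fun a _ => ?_
  congr 1
  simp [-Fintype.sum_sum_type, map_sum, hE.dual p hp]

omit hW he hc hWc hF in
theorem sasakiMetric_apply_frame {p : SphereBundle m M} (hp : p ∈ W)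
    (v : TangentSpace 𝓘(ℝ, Vec (m + 1) × Vec m) p) (b : Fin (m + 1) ⊕ Fin m) :
    sasakiMetric (coframe F c e) p v (E b p) = coframe F c e b p v := by
  unfold sasakiMetric
  rw [LinearMap.sum_apply, LinearMap.sum_apply]
  refine (Finset.sum_eq_single b (fun a _ hab => ?_) (by simp)).trans ?_
  · simp [LinearMap.BilinForm.linMulLin_apply, hE.dual p hp, hab]
  · simp [LinearMap.BilinForm.linMulLin_apply, hE.dual p hp]

omit hE in
theorem mem_vertical_iff_coframe {p : SphereBundle m M} (hp : p ∈ W)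
    (v : TangentSpace 𝓘(ℝ, Vec (m + 1) × Vec m) p) :
    v ∈ vertical p ↔ ∀ i, coframe F c e (Sum.inl i) p v = 0 := by
  -- a vector at `p` is the value of a vector field, constant in the trivial identification
  -- of the tangent spaces with the model space
  have h1 := mem_vertical_iff hW he hc hWc hp (fun _ => (v : Vec (m + 1) × Vec m))
  have h2 := fun i => coframe_inl_apply hW he hc hWc hF hp i (fun _ => (v : Vec (m + 1) × Vec m))
  refine h1.trans ⟨fun h i => (h2 i).trans ?_, fun h => eq_zero_of_frameForm he hc hWc hF hp
    fun i => (h2 i).symm.trans (h i)⟩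
  rw [h]
  simpa using frameForm_smul (F := F) (c := c) (e := e) i p 0 0

/-- The orthogonal projection onto the horizontal space drops the components `ω^{n+α}`. -/
theorem horProj_eq {p : SphereBundle m M} (hp : p ∈ W)
    (v : TangentSpace 𝓘(ℝ, Vec (m + 1) × Vec m) p) :
    horProj (sasakiMetric (coframe F c e)) p v =
      ∑ i, coframe F c e (Sum.inl i) p v • E (Sum.inl i) p := by
  have hver := mem_vertical_iff_coframe hW he hc hWc hF hp
  have hhor : ∀ U, U ∈ horizontal (sasakiMetric (coframe F c e)) p ↔
      ∀ α, coframe F c e (Sum.inr α) p U = 0 := by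
    intro U
    constructor
    · intro h α
      have h1 : E (Sum.inr α) p ∈ vertical p := (hver _).2 fun i => by simp [hE.dual p hp]
      have h2 : sasakiMetric (coframe F c e) p (E (Sum.inr α) p) U = 0 := h _ h1
      rw [← h2, ← sasakiMetric_apply_frame hE hp]
      unfold sasakiMetric
      simp only [LinearMap.sum_apply, LinearMap.BilinForm.linMulLin_apply]
      exact Finset.sum_congr rfl fun a _ => mul_comm _ _
    · intro h w hw
      have h1 := (hver w).1 hw
      show sasakiMetric (coframe F c e) p w U = 0
      unfold sasakiMetric
      simp [LinearMap.sum_apply, LinearMap.BilinForm.linMulLin_apply, h, h1]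
  have hex : ∃ U, U ∈ horizontal (sasakiMetric (coframe F c e)) p ∧ v - U ∈ vertical p := by
    refine ⟨∑ i, coframe F c e (Sum.inl i) p v • E (Sum.inl i) p, (hhor _).2 fun α => ?_,
      (hver _).2 fun i => ?_⟩
    · simp [map_sum, hE.dual p hp]
    · simp [map_sum, hE.dual p hp]
  obtain ⟨h1, h2⟩ := Classical.epsilon_spec hex
  have h3 := eq_sum_coframe hE hp (horProj (sasakiMetric (coframe F c e)) p v)
  rw [Fintype.sum_sum_type] at h3
  rw [h3]
  have h4 := (hhor _).1 h1
  have h5 := (hver _).1 h2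
  have h6 : ∀ i, coframe F c e (Sum.inl i) p (horProj (sasakiMetric (coframe F c e)) p v) =
      coframe F c e (Sum.inl i) p v := fun i => by
    have := h5 i
    rw [map_sub, sub_eq_zero] at this
    exact this.symm
  have h7 : ∀ α, coframe F c e (Sum.inr α) p (horProj (sasakiMetric (coframe F c e)) p v) = 0 := h4
  simp [h6, h7]

end
end DualFrame

/-! ### The Bott connection -/

section Bott

variable {m : ℕ} {M : Type*} [TopologicalSpace M] [ChartedSpace (Vec (m + 1)) M]
  [IsManifold (𝓡 (m + 1)) ∞ M]
  {F : TangentBundle (𝓡 (m + 1)) M → ℝ} {c : OpenPartialHomeomorph M (Vec (m + 1))}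
  {W : Set (SphereBundle m M)} {e : PullbackFrame m M}
  (hW : IsOpen W) (he : IsAdaptedFrame F c W e)
  (hc : c ∈ IsManifold.maximalAtlas (𝓡 (m + 1)) ∞ M) (hWc : ∀ p ∈ W, p.pt ∈ c.source)
  (hF : IsFinsler F)
  {E : Fin (m + 1) ⊕ Fin m → VField (Vec (m + 1) × Vec m) (SphereBundle m M)}
  (hE : IsDualFrame W (coframe F c e) E)
  {D : VField (Vec (m + 1) × Vec m) (SphereBundle m M) →
      VField (Vec (m + 1) × Vec m) (SphereBundle m M) →
      VField (Vec (m + 1) × Vec m) (SphereBundle m M)}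
  (hD : IsLeviCivitaOn W (sasakiMetric (coframe F c e)) D)

include hW he hc hWc hF

theorem contMDiffOn_coframe_inl (i : Fin (m + 1))
    {X : VField (Vec (m + 1) × Vec m) (SphereBundle m M)} (hX : SmoothFieldOn W X) :
    ContMDiffOn 𝓘(ℝ, Vec (m + 1) × Vec m) 𝓘(ℝ, ℝ) ∞
      (fun p => coframe F c e (Sum.inl i) p (X p)) W := by
  have hx := contMDiffOn_baseCoord he hc hWc
  have hu := contMDiffOn_frameCoord he hc hWc
  have h0 : ContMDiffOn 𝓘(ℝ, Vec (m + 1) × Vec m) 𝓘(ℝ, Vec (m + 1)) ∞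
      (fun _ : SphereBundle m M => (0 : Vec (m + 1))) W := contMDiffOn_const
  have h1 := (isSpray_coordF hF hc).contDiffOn_fderiv_fderiv.contMDiffOn.comp
    (hx.prodMk_space (hu (Fin.last m))) fun p hp => point_mem he hc hWc hF hp
  have h2 := (h1.clm_apply (h0.prodMk_space (hu i))).clm_apply
    (h0.prodMk_space (contMDiffOn_lieD hW hx hX))
  have h3 : ContMDiffOn 𝓘(ℝ, Vec (m + 1) × Vec m) 𝓘(ℝ, ℝ) ∞
      (fun _ : SphereBundle m M => (1 / 2 : ℝ)) W := contMDiffOn_const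
  refine (h3.smul h2).congr fun p hp => ?_
  rw [coframe_inl_apply hW he hc hWc hF hp]
  rfl

include hE hD

/-- The Bott connection in the adapted frame. The right hand side depends on `X` only through `X p`,
which gives the connection forms. -/
theorem bott_eq_sum {X : VField (Vec (m + 1) × Vec m) (SphereBundle m M)}
    (hX : SmoothFieldOn W X) {p : SphereBundle m M} (hp : p ∈ W) (i : Fin (m + 1)) :
    bott (sasakiMetric (coframe F c e)) D X (E (Sum.inl i)) p =
      ∑ j, (∑ β, coframe F c e (Sum.inr β) p (X p) * coframe F c e (Sum.inl j) p
          (VectorField.mlieBracket 𝓘(ℝ, Vec (m + 1) × Vec m) (E (Sum.inr β)) (E (Sum.inl i)) p) +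
        ∑ k, coframe F c e (Sum.inl k) p (X p) * coframe F c e (Sum.inl j) p
          (D (E (Sum.inl k)) (E (Sum.inl i)) p)) • E (Sum.inl j) p := by
  have hM := isMovingFrame hW he hc hWc hF hE
  let f : Fin (m + 1) → SphereBundle m M → ℝ := fun k q => coframe F c e (Sum.inl k) q (X q)
  have hf : ∀ k, ContMDiffOn 𝓘(ℝ, Vec (m + 1) × Vec m) 𝓘(ℝ, ℝ) ∞ (f k) W :=
    fun k => contMDiffOn_coframe_inl hW he hc hWc hF k hX
  have hHeq : ∀ q ∈ W, horProj (sasakiMetric (coframe F c e)) q (X q) =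
      ∑ k, f k q • E (Sum.inl k) q := fun q hq => horProj_eq hW he hc hWc hF hE hq (X q)
  have hS := SmoothFieldOn.sum_smul Finset.univ hf fun k => hE.smooth (Sum.inl k)
  have hH : SmoothFieldOn W (fun q => horProj (sasakiMetric (coframe F c e)) q (X q)) :=
    hS.congr hHeq
  have hV := hX.sub hH
  -- the horizontal part
  have h1 : D (fun q => horProj (sasakiMetric (coframe F c e)) q (X q)) (E (Sum.inl i)) p =
      ∑ k, f k p • D (E (Sum.inl k)) (E (Sum.inl i)) p := by
    rw [hD.congr_left hH hS (hE.smooth _) hHeq hp,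
      hD.sum_smul_left Finset.univ hf (fun k => hE.smooth (Sum.inl k)) (hE.smooth _) hp]
  -- the vertical part
  have hVeq : ∀ q ∈ W, X q - horProj (sasakiMetric (coframe F c e)) q (X q) =
      ∑ β, coframe F c e (Sum.inr β) q (X q) • E (Sum.inr β) q := by
    intro q hq
    have h := eq_sum_coframe hE hq (X q)
    rw [Fintype.sum_sum_type] at h
    rw [hHeq q hq, sub_eq_iff_eq_add', ← h]
  have hVb : ∀ q ∈ W, lieD (baseCoord c)
      (fun q => X q - horProj (sasakiMetric (coframe F c e)) q (X q)) q = 0 := by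
    intro q hq
    refine (mem_vertical_iff hW he hc hWc hq _).1 ?_
    rw [mem_vertical_iff_coframe hW he hc hWc hF hq, hVeq q hq]
    intro i
    simp [map_sum, hE.dual q hq]
  have h2 : ∀ j, coframe F c e (Sum.inl j) p (VectorField.mlieBracket 𝓘(ℝ, Vec (m + 1) × Vec m)
      (fun q => X q - horProj (sasakiMetric (coframe F c e)) q (X q)) (E (Sum.inl i)) p) =
      ∑ β, coframe F c e (Sum.inr β) p (X p) * coframe F c e (Sum.inl j) p
          (VectorField.mlieBracket 𝓘(ℝ, Vec (m + 1) × Vec m) (E (Sum.inr β)) (E (Sum.inl i)) p) := by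
    intro j
    rw [coframe_inl_apply hW he hc hWc hF hp, hM.lieD_bracket_of_vertical hV hVb i hp]
    have h3 : lieD (frameCoord c e i)
        (fun q => X q - horProj (sasakiMetric (coframe F c e)) q (X q)) p =
        ∑ β, coframe F c e (Sum.inr β) p (X p) • lieD (frameCoord c e i) (E (Sum.inr β)) p := by
      exact (congrArg (mfderiv 𝓘(ℝ, Vec (m + 1) × Vec m) 𝓘(ℝ, Vec (m + 1)) (frameCoord c e i) p)
        (hVeq p hp)).trans ((map_sum _ _ _).trans
          (Finset.sum_congr rfl fun β _ => map_smul _ _ _))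
    let φ : Vec (m + 1) →ₗ[ℝ] ℝ := ⟨⟨frameForm F c e j p, frameForm_add j p⟩, frameForm_smul j p⟩
    rw [h3]
    refine (map_sum φ _ _).trans (Finset.sum_congr rfl fun β _ => ?_)
    rw [coframe_inl_apply hW he hc hWc hF hp,
      hM.lieD_bracket_of_vertical (hE.smooth _) (fun q hq => hM.base_vertical q hq β) i hp]
    exact frameForm_smul j p _ _
  unfold bott
  rw [horProj_eq hW he hc hWc hF hE hp, horProj_eq hW he hc hWc hF hE hp,
    ← Finset.sum_add_distrib]
  refine Finset.sum_congr rfl fun j _ => ?_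
  rw [h2, h1, ← add_smul, map_sum]
  congr 2
  exact Finset.sum_congr rfl fun k _ => map_smul _ _ _

/-- The Levi-Civita coefficients `⟨∇_{e_k} e_i, e_n⟩ = -⟨∇_{e_k} e_n, e_i⟩` with horizontal `e_k`, `e_i`
vanish: in the Koszul formula the bracket `[e_k, e_i]` has no component along `e_n`, and the two
others cancel because `e_n` preserves the horizontal metric. -/
theorem coframe_last_leviCivita {p : SphereBundle m M} (hp : p ∈ W) (k i : Fin (m + 1)) :
    coframe F c e (Sum.inl (Fin.last m)) p (D (E (Sum.inl k)) (E (Sum.inl i)) p) = 0 ∧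
    coframe F c e (Sum.inl i) p (D (E (Sum.inl k)) (E (Sum.inl (Fin.last m))) p) = 0 := by
  have hM := isMovingFrame hW he hc hWc hF hE
  have hsym : ∀ p ∈ W, ∀ v w, sasakiMetric (coframe F c e) p v w =
      sasakiMetric (coframe F c e) p w v := by
    intro p _ v w
    unfold sasakiMetric
    simp only [LinearMap.sum_apply, LinearMap.BilinForm.linMulLin_apply]
    exact Finset.sum_congr rfl fun a _ => mul_comm _ _
  have hon : ∀ p ∈ W, ∀ a b, sasakiMetric (coframe F c e) p (E a p) (E b p) =
      if a = b then 1 else 0 := by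
    intro p hp a b
    rw [sasakiMetric_apply_frame hE hp, hE.dual p hp]
    exact if_congr eq_comm rfl rfl
  obtain ⟨h1, h2⟩ := hD.koszul hW hE.smooth hon hsym hp (Sum.inl k) (Sum.inl i)
    (Sum.inl (Fin.last m))
  simp only [sasakiMetric_apply_frame hE hp] at h1 h2
  have h3 := hM.hilbert_bracket_horizontal k i hp
  have h4 := hM.bracket_reeb_antisymm i k hp
  have e1 := coframe_inl_apply hW he hc hWc hF hp (Fin.last m)
    (VectorField.mlieBracket 𝓘(ℝ, Vec (m + 1) × Vec m) (E (Sum.inl k)) (E (Sum.inl i)))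
  have e2 := coframe_inl_apply hW he hc hWc hF hp k
    (VectorField.mlieBracket 𝓘(ℝ, Vec (m + 1) × Vec m) (E (Sum.inl i)) (E (Sum.inl (Fin.last m))))
  have e3 := coframe_inl_apply hW he hc hWc hF hp i
    (VectorField.mlieBracket 𝓘(ℝ, Vec (m + 1) × Vec m) (E (Sum.inl (Fin.last m))) (E (Sum.inl k)))
  have e4 := coframe_inl_apply hW he hc hWc hF hp k
    (VectorField.mlieBracket 𝓘(ℝ, Vec (m + 1) × Vec m) (E (Sum.inl (Fin.last m))) (E (Sum.inl i)))
  have e5 : coframe F c e (Sum.inl k) p (VectorField.mlieBracket 𝓘(ℝ, Vec (m + 1) × Vec m)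
      (E (Sum.inl i)) (E (Sum.inl (Fin.last m))) p) = -coframe F c e (Sum.inl k) p
      (VectorField.mlieBracket 𝓘(ℝ, Vec (m + 1) × Vec m)
        (E (Sum.inl (Fin.last m))) (E (Sum.inl i)) p) := by
    rw [VectorField.mlieBracket_swap_apply, map_neg]
  unfold frameForm at e1 e3 e4
  constructor <;> linarith

end Bott

theorem corollary1 {m : ℕ} {M : Type*} [TopologicalSpace M] [ChartedSpace (Vec (m + 1)) M]
    [IsManifold (𝓡 (m + 1)) ∞ M]
    (F : TangentBundle (𝓡 (m + 1)) M → ℝ) (hF : IsFinsler F)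
    (c : OpenPartialHomeomorph M (Vec (m + 1)))
    (hc : c ∈ IsManifold.maximalAtlas (𝓡 (m + 1)) ∞ M)
    (W : Set (SphereBundle m M)) (hW : IsOpen W) (hWc : ∀ p ∈ W, p.pt ∈ c.source)
    (e : PullbackFrame m M) (he : IsAdaptedFrame F c W e)
    (E : Fin (m + 1) ⊕ Fin m → VField (Vec (m + 1) × Vec m) (SphereBundle m M))
    (hE : IsDualFrame W (coframe F c e) E)
    (D : VField (Vec (m + 1) × Vec m) (SphereBundle m M) →
      VField (Vec (m + 1) × Vec m) (SphereBundle m M) →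
      VField (Vec (m + 1) × Vec m) (SphereBundle m M))
    (hD : IsLeviCivitaOn W (sasakiMetric (coframe F c e)) D) :
    (∃ Γ, IsConnectionMatrix W (bott (sasakiMetric (coframe F c e)) D)
      (fun i => E (Sum.inl i)) Γ) ∧
    ∀ Γ, IsConnectionMatrix W (bott (sasakiMetric (coframe F c e)) D)
        (fun i => E (Sum.inl i)) Γ →
      ∀ p ∈ W,
        (∀ α : Fin m,
          Γ α.castSucc (Fin.last m) p = coframe F c e (Sum.inr α) p ∧
          -Γ (Fin.last m) α.castSucc p = coframe F c e (Sum.inr α) p) ∧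
        Γ (Fin.last m) (Fin.last m) p = 0 := by
  have hM := isMovingFrame hW he hc hWc hF hE
  constructor
  · refine ⟨fun i j p =>
      ∑ β, coframe F c e (Sum.inl j) p (VectorField.mlieBracket 𝓘(ℝ, Vec (m + 1) × Vec m)
        (E (Sum.inr β)) (E (Sum.inl i)) p) • coframe F c e (Sum.inr β) p +
      ∑ k, coframe F c e (Sum.inl j) p (D (E (Sum.inl k)) (E (Sum.inl i)) p) •
        coframe F c e (Sum.inl k) p, ?_⟩
    intro X hX p hp i
    rw [bott_eq_sum hW he hc hWc hF hE hD hX hp i]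
    refine Finset.sum_congr rfl fun j _ => ?_
    congr 1
    simp only [add_apply, sum_apply, smul_apply, smul_eq_mul]
    exact congrArg₂ (· + ·) (Finset.sum_congr rfl fun _ _ => mul_comm _ _)
      (Finset.sum_congr rfl fun _ _ => mul_comm _ _)
  · intro Γ hΓ p hp
    -- the connection forms are determined by their values on the frame
    have hval : ∀ a i j, Γ i j p (E a p) = coframe F c e (Sum.inl j) p
        (bott (sasakiMetric (coframe F c e)) D (E a) (E (Sum.inl i)) p) := by
      intro a i j
      rw [hΓ (E a) (hE.smooth a) p hp i]
      simp [map_sum, hE.dual p hp]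
    have hver : ∀ β i j, Γ i j p (E (Sum.inr β) p) = coframe F c e (Sum.inl j) p
        (VectorField.mlieBracket 𝓘(ℝ, Vec (m + 1) × Vec m) (E (Sum.inr β)) (E (Sum.inl i)) p) := by
      intro β i j
      rw [hval, bott_eq_sum hW he hc hWc hF hE hD (hE.smooth _) hp i]
      simp [map_sum, hE.dual p hp]
    have hhor : ∀ k i j, Γ i j p (E (Sum.inl k) p) = coframe F c e (Sum.inl j) p
        (D (E (Sum.inl k)) (E (Sum.inl i)) p) := by
      intro k i j
      rw [hval, bott_eq_sum hW he hc hWc hF hE hD (hE.smooth _) hp i]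
      simp [map_sum, hE.dual p hp]
    have hext : ∀ T T' : TangentSpace 𝓘(ℝ, Vec (m + 1) × Vec m) p →L[ℝ] ℝ,
        (∀ k, T (E (Sum.inl k) p) = T' (E (Sum.inl k) p)) →
        (∀ β, T (E (Sum.inr β) p) = T' (E (Sum.inr β) p)) → T = T' := by
      intro T T' h1 h2
      ext v
      rw [eq_sum_coframe hE hp v]
      simp only [Fintype.sum_sum_type, map_add, map_sum, map_smul, h1, h2]
    have hhil : ∀ β i, coframe F c e (Sum.inl (Fin.last m)) p
        (VectorField.mlieBracket 𝓘(ℝ, Vec (m + 1) × Vec m) (E (Sum.inr β)) (E (Sum.inl i)) p) =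
          if β.castSucc = i then 1 else 0 := by
      intro β i
      have h := hM.hilbert_bracket_vertical β i hp
      rw [coframe_inl_apply hW he hc hWc hF hp]
      unfold frameForm
      rw [h]
      split_ifs <;> norm_num
    refine ⟨fun α => ⟨hext _ _ (fun k => ?_) fun β => ?_, hext _ _ (fun k => ?_) fun β => ?_⟩,
      hext _ _ (fun k => ?_) fun β => ?_⟩
    · rw [hhor, (coframe_last_leviCivita hW he hc hWc hF hE hD hp k _).1, hE.dual p hp]
      simp
    · rw [hver, hhil, hE.dual p hp]
      simp [eq_comm]
    · rw [neg_apply, hhor, (coframe_last_leviCivita hW he hc hWc hF hE hD hp k _).2, hE.dual p hp]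
      simp
    · rw [neg_apply, hver, coframe_inl_apply hW he hc hWc hF hp, hM.bracket_vertical_reeb β hp,
        frameForm_neg, frameForm_frameCoord he hc hWc hF hp, hE.dual p hp]
      simp
    · rw [hhor, (coframe_last_leviCivita hW he hc hWc hF hE hD hp k _).1]
      rfl
    · rw [hver, hhil, if_neg (Fin.castSucc_lt_last β).ne]
      rfl
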